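/- **Theorem 2 (Stability).** For $x,z\in\mathbb C^n$ let $\mathrm{dist}(x,z)=\min_{\phi\in[0,2\pi)}\|e^{i\phi}x-z\|$ and $\mathcal S_x(\rho)=\{z\in\mathbb C^n:\mathrm{dist}(x,z)\le\rho\|x\|\}$. Given $a_1,\dots,a_m\in\mathbb C^n$, a nonzero signal $x\in\mathbb C^n$, backgrounds $b\in\mathbb R^m$ and noise $\eta\in\mathbb R^m$, put $y_j=|a_j^*x|^2+b_j+\eta_j$, and let Wirtinger Flow (WF) with step size $\mu$ be $$z_{k+1}=z_k-\mu\nabla f(z_k),\qquad \nabla f(z)=\frac1m\sum_{j=1}^m\Big(1-\frac{y_j}{|a_j^*z|^2+b_j}\Big)a_ja_j^*z .$$ For $0<\alpha_1\le\alpha_2$ and $\rho>0$ write $\rho_1=\frac{2\sqrt{76015}-276}{2477}$, $\rho_2=\frac{2\sqrt{39}-12}{3}$, $\tau=\frac{8075-\sqrt{45678865}}{990}$, and call $(\alpha_1,\alpha_2,\rho)$ *admissible* if either $\rho\le\rho_1$ and $\alpha_2<3\alpha_1-(1+\rho)^2$, or $\rho_1<\rho\le\rho_2$ and $\alpha_2<\Big(3-\frac{(3-\tau)(\rho-\rho_1)}{1/6-\rho_1}\Big)\alpha_1-(1+\rho)^2$.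 With $U=(1+\rho)^2+\alpha_2$, $\Phi_1=\frac{1-6\rho}{4U}-\frac{\rho^2}{16((1-\rho)^2+\alpha_1)}$, $\Phi_2=\frac{9+16\rho^2}{32U}-\frac{3}{32\alpha_1}$, $\psi=\frac{63}{128U}-\frac{9}{128\alpha_1}$ and $\varphi=\frac{81U\rho^2}{U^2(7+16U\psi)}$, put $$l_{cur}=\min\Big\{\tfrac14(\Phi_1+\Phi_2-\varphi),\ \tfrac{2-3\rho+\rho^2}{U}\Big\},\qquad u_{smo}=1+\frac1{2\sqrt{\alpha_1}} .$$ Let $0<\alpha_1\le\alpha_2$. There is $\rho_0>0$ such that for every $\rho>0$ with $\rho\le\rho_0$ or $(\alpha_1,\alpha_2,\rho)$ admissible there is $\mu_0>0$ such that for every $\mu>0$ with $\mu<\mu_0$, or with $(\alpha_1,\alpha_2,\rho)$ admissible and $\mu<2l_{cur}/u_{smo}^2$, and for every $c>0$, there are constants $C,c_1,c_2>0$ and $t_1\in(0,1)$, and for each $C_x>0$ a constant $c_3=c_3(C_x)>0$, none of them depending on $n$, $m$ or $x$, with the following property. Let $m\ge Cn$, let $x\in\mathbb C^n$ be nonzero,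 and let $a_1,\dots,a_m$ be independent random vectors in $\mathbb C^n$ with law $\mathcal N(0,I_n/2)+i\,\mathcal N(0,I_n/2)$. Then with probability greater than $1-c_1\exp(-c_2m)$ the following holds: for every $C_x>0$ with $|a_j^*x|\ge C_x\|x\|$ for all $j$, all $b$ with $\alpha_1|a_j^*x|^2\le b_j\le\alpha_2|a_j^*x|^2$ for all $j$, all $\eta\in\mathbb R^m$ with $\|\eta\|/\sqrt m\le c\|x\|$, all $z_0\in\mathcal S_x(\rho)$ and all $k\ge0$, the WF iterates satisfy $$\mathrm{dist}(z_{k+1},x)\le c_3(C_x)\,\frac{\|\eta\|}{\sqrt m\,\|x\|}+(1-t_1)^{\frac{k+1}{2}}\|x\| .$$ -/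

import Mathlib

open MeasureTheory ProbabilityTheory

noncomputable section

namespace PoissonWF

/-- The signal space `ℂⁿ` with its Euclidean norm. -/
abbrev Vec (n : ℕ) : Type := EuclideanSpace ℂ (Fin n)

/-- The standard complex Gaussian law on `ℂ`: the law of `u + i v` with `u`, `v` independent
real Gaussians of mean `0` and variance `1/2`. -/
def stdComplexGaussian : Measure ℂ :=
  ((gaussianReal 0 (1 / 2)).prod (gaussianReal 0 (1 / 2))).map
    (fun p : ℝ × ℝ => (p.1 : ℂ) + (p.2 : ℂ) * Complex.I)

/-- The law `N(0, I_n / 2) + i N(0, I_n / 2)` on `ℂⁿ`: independent standard complex Gaussian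
coordinates. -/
def stdComplexGaussianVec (n : ℕ) : Measure (Vec n) :=
  (Measure.pi (fun _ : Fin n => stdComplexGaussian)).map (WithLp.toLp 2)

/-- Distance modulo a global phase: the minimum over `φ ∈ [0, 2π)` of `‖e^{iφ} x - z‖`. -/
def phaseDist {n : ℕ} (x z : Vec n) : ℝ :=
  ⨅ φ : Set.Ico (0 : ℝ) (2 * Real.pi), ‖Complex.exp ((φ : ℝ) * Complex.I) • x - z‖

/-- The `ρ`-neighbourhood `S_x(ρ)` of `x`. -/
def nbhd {n : ℕ} (x : Vec n) (ρ : ℝ) : Set (Vec n) :=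
  {z | phaseDist x z ≤ ρ * ‖x‖}

/-- The Wirtinger gradient
`∇f(z) = (1/m) ∑ⱼ (1 - yⱼ / (|aⱼ^* z|² + bⱼ)) aⱼ aⱼ^* z` of the Poisson negative log-likelihood
`f(z) = (1/m) ∑ⱼ (|aⱼ^* z|² + bⱼ - yⱼ log (|aⱼ^* z|² + bⱼ))`. Here `inner ℂ u v = u^* v`. -/
def wfGrad {n m : ℕ} (a : Fin m → Vec n) (y b : Fin m → ℝ) (z : Vec n) : Vec n :=
  (1 / (m : ℝ)) •
    ∑ j, (1 - y j / (‖inner ℂ (a j) z‖ ^ 2 + b j)) • (inner ℂ (a j) z • a j)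

/-- The Wirtinger Flow iterates `z₀`, `z_{k+1} = z_k - μ ∇f(z_k)`. -/
def wfIter {n m : ℕ} (a : Fin m → Vec n) (y b : Fin m → ℝ) (μ : ℝ) (z₀ : Vec n) : ℕ → Vec n
  | 0 => z₀
  | k + 1 => wfIter a y b μ z₀ k - μ • wfGrad a y b (wfIter a y b μ z₀ k)

/-- The noisy measurements `yⱼ = |aⱼ^* x|² + bⱼ + ηⱼ`. -/
def noisyMeas {n m : ℕ} (a : Fin m → Vec n) (x : Vec n) (b η : Fin m → ℝ) (j : Fin m) : ℝ :=
  ‖inner ℂ (a j) x‖ ^ 2 + b j + η j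

/-- The first threshold for the radius, approximately `0.11119`. -/
def rho1 : ℝ := (2 * √76015 - 276) / 2477

/-- The second threshold for the radius, approximately `0.16333`. -/
def rho2 : ℝ := (2 * √39 - 12) / 3

/-- The constant entering the second range of radii, approximately `1.32968`. -/
def tau2 : ℝ := (8075 - √45678865) / 990

/-- The explicit range of background ratios `α₁, α₂` and radii `ρ`. -/
def Admissible (α₁ α₂ ρ : ℝ) : Prop :=
  0 < α₁ ∧ α₁ ≤ α₂ ∧
    ((0 < ρ ∧ ρ ≤ rho1 ∧ α₂ < 3 * α₁ - (ρ + 1) ^ 2) ∨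
      (rho1 < ρ ∧ ρ ≤ rho2 ∧
        α₂ < (3 - (3 - tau2) * (ρ - rho1) / (1 / 6 - rho1)) * α₁ - (ρ + 1) ^ 2))

/-- `U = (1 + ρ)² + α₂`. -/
def curvU (α₂ ρ : ℝ) : ℝ := (1 + ρ) ^ 2 + α₂

/-- `Φ₁ = (1 - 6ρ) / (4U) - ρ² / (16 L₁)` with `L₁ = (1 - ρ)² + α₁`. -/
def curvPhi1 (α₁ α₂ ρ : ℝ) : ℝ :=
  (1 - 6 * ρ) / (4 * curvU α₂ ρ) - ρ ^ 2 / (16 * ((1 - ρ) ^ 2 + α₁))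

/-- `Φ₂ = (9 + 16ρ²) / (32U) - 3 / (32 L₂)` with `L₂ = α₁`. -/
def curvPhi2 (α₁ α₂ ρ : ℝ) : ℝ :=
  (9 + 16 * ρ ^ 2) / (32 * curvU α₂ ρ) - 3 / (32 * α₁)

/-- `ψ = 63 / (128U) - 9 / (128 L₂)` with `L₂ = α₁`. -/
def curvPsi (α₁ α₂ ρ : ℝ) : ℝ :=
  63 / (128 * curvU α₂ ρ) - 9 / (128 * α₁)

/-- `φ = 81 U ρ² / (U² (7 + 16 U ψ))`. -/
def curvVarphi (α₁ α₂ ρ : ℝ) : ℝ :=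
  81 * curvU α₂ ρ * ρ ^ 2 /
    (curvU α₂ ρ ^ 2 * (7 + 16 * curvU α₂ ρ * curvPsi α₁ α₂ ρ))

/-- The local curvature constant (in the limit `δ → 0` of the slack `δ > 0`). -/
def lCur (α₁ α₂ ρ : ℝ) : ℝ :=
  min ((curvPhi1 α₁ α₂ ρ + curvPhi2 α₁ α₂ ρ - curvVarphi α₁ α₂ ρ) / 4)
    ((2 - 3 * ρ + ρ ^ 2) / curvU α₂ ρ)

/-- The local smoothness constant (in the limit `δ → 0` of the slack `δ > 0`). -/
def uSmo (α₁ : ℝ) : ℝ := 1 + 1 / (2 * √α₁)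

end PoissonWF

end

/-! All randomness is confined to one event, `IsRegular`, which involves only the samples and the
direction e = x/‖x‖. On it every estimate is deterministic, so one probability bound covers all b,
η, z₀, k and C_x at once.

Curvature: let u be the phase bringing x closest to z and put h = z - u x; optimality makes ⟨u x, h⟩
real. With G = a_j^*(u x) and w = a_j^* h, the noiseless part of Re⟨h, ∇f(z)⟩ coming from sample j
is at least 1/(1+α₂) times Re(conj(G) w)²/|G|² - β |w|² min(|w|²/|G|², 1), where β = 1 +
(1+α₂)/(4α₁) (`curvature_coeff`). Because of the truncation by 1, this minorant is O(|w|²) and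
locally Lipschitz in w uniformly in G, however small |G| is. A Bernstein bound and an ε-net
therefore control its average over all aligned directions once m ≥ Cn
(`sampleLaw_not_isRegular_le`). Its Gaussian mean is at least 1/2 - 2βρ²(1 + log ρ⁻²)
(`integral_curvMinorant_ge`). Alignment is essential: along the direction i·x the leading square
vanishes.

Contraction: the noiseless gradient has norm at most D·`uSmo`·‖h‖, D being the upper frame constant.
Expanding ‖h - μg‖² then gives a factor q < 1 for small μ (`IsRegular.norm_signal_step_le`).

Noise: each step adds an error of size at most E, proportional to ‖η‖/(√m ‖x‖). If E ≤ (1-q)ρ‖x‖,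
the ρ-neighbourhood is invariant and the errors sum geometrically. Otherwise ‖x‖ is itself bounded
by a multiple of E, and it suffices that the iterates stay bounded by a multiple of ‖x‖ + E, which
`IsRegular.norm_step_le` gives without any closeness to x (`IsRegular.phaseDist_wfIter_le`).

The explicit range of radii and steps is covered because admissibility makes `curvBound` positive
and `lCur` is at most `curvBound`/(1+α₂) (`Admissible.curvBound_pos`, `Admissible.lCur_le`). -/

noncomputable section

namespace PoissonWF

/-! ### Phases, the curvature minorant, and alignment modulo a global phase -/

/-- The phase of a complex number, with the convention that the phase of `0` is `1`. -/
def unitPhase (g : ℂ) : ℂ := if g = 0 then 1 else g / (‖g‖ : ℂ)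

lemma norm_unitPhase (g : ℂ) : ‖unitPhase g‖ = 1 := by
  unfold unitPhase
  split_ifs with h
  · simp
  · simp [h]

/-- A minorant of the curvature contribution of one sample, as a function of `g = a^* x` and
`w = a^* h`. -/
def curvMinorant (β κ : ℝ) (g w : ℂ) : ℝ :=
  ((starRingEnd ℂ (unitPhase g) * w).re) ^ 2 - β * (‖w‖ ^ 2 * min (κ * (‖w‖ ^ 2 / ‖g‖ ^ 2)) 1)

lemma exists_phase_mul_eq_norm (w : ℂ) : ∃ u : ℂ, ‖u‖ = 1 ∧ starRingEnd ℂ u * w = ‖w‖ := by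
  refine ⟨unitPhase w, norm_unitPhase w, ?_⟩
  unfold unitPhase
  split_ifs with h
  · simp [h]
  · have : (‖w‖ : ℂ) ≠ 0 := by simpa using h
    rw [map_div₀, Complex.conj_ofReal, div_mul_eq_mul_div, Complex.conj_mul']
    field_simp

lemma phaseDist_le {n : ℕ} (x z : Vec n) {u : ℂ} (hu : ‖u‖ = 1) :
    phaseDist x z ≤ ‖u • x - z‖ := by
  obtain ⟨φ, hφ, rfl⟩ : ∃ φ ∈ Set.Ico (0 : ℝ) (2 * Real.pi),
      Complex.exp ((φ : ℝ) * Complex.I) = u := by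
    refine ⟨toIcoMod Real.two_pi_pos 0 u.arg, by simpa using toIcoMod_mem_Ico Real.two_pi_pos 0 u.arg,
      ?_⟩
    have h1 : u = Complex.exp (u.arg * Complex.I) := by
      conv_lhs => rw [← Complex.norm_mul_exp_arg_mul_I u, hu]
      simp
    conv_rhs => rw [h1]
    rw [Complex.exp_eq_exp_iff_exists_int]
    refine ⟨-toIcoDiv Real.two_pi_pos 0 u.arg, ?_⟩
    have := self_sub_toIcoDiv_zsmul Real.two_pi_pos 0 u.arg
    rw [← this]
    push_cast [zsmul_eq_mul]
    ring
  exact ciInf_le (f := fun φ : Set.Ico (0 : ℝ) (2 * Real.pi) =>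
    ‖Complex.exp ((φ : ℝ) * Complex.I) • x - z‖)
    ⟨0, by rintro _ ⟨φ, rfl⟩; positivity⟩ ⟨φ, hφ⟩

lemma phaseDist_symm_le {n : ℕ} (x z : Vec n) {u : ℂ} (hu : ‖u‖ = 1) :
    phaseDist z x ≤ ‖u • x - z‖ := by
  have hu' : ‖starRingEnd ℂ u‖ = 1 := by simpa using hu
  refine (phaseDist_le z x hu').trans_eq ?_
  have h : starRingEnd ℂ u • z - x = -(starRingEnd ℂ u • (u • x - z)) := by
    rw [smul_sub, smul_smul, Complex.conj_mul', hu]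
    simp
  rw [h, norm_neg, norm_smul, hu', one_mul]

/-- The distance modulo phase is attained at a phase which makes the inner product real. -/
lemma exists_phase_alignment {n : ℕ} (x z : Vec n) :
    ∃ u : ℂ, ‖u‖ = 1 ∧ ‖u • x - z‖ = phaseDist x z ∧ (inner ℂ (u • x) (z - u • x)).im = 0 := by
  -- Since ‖v x - z‖² = ‖x‖² + ‖z‖² - 2 Re⟨v x, z⟩ for |v| = 1, the best phase is the one turning
  -- ⟨x, z⟩ into its modulus.
  obtain ⟨u, hu, huw⟩ := exists_phase_mul_eq_norm (inner ℂ x z)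
  have hin : inner ℂ (u • x) z = (‖inner ℂ x z‖ : ℂ) := by
    rw [inner_smul_left, huw]
  refine ⟨u, hu, le_antisymm ?_ (phaseDist_le x z hu), ?_⟩
  · have : Nonempty (Set.Ico (0 : ℝ) (2 * Real.pi)) := ⟨⟨0, by simp [Real.pi_pos]⟩⟩
    refine le_ciInf fun φ => ?_
    set v := Complex.exp ((φ : ℝ) * Complex.I)
    have hv : ‖v‖ = 1 := Complex.norm_exp_ofReal_mul_I _
    refine le_of_sq_le_sq ?_ (norm_nonneg _)
    rw [norm_sub_sq (𝕜 := ℂ), norm_sub_sq (𝕜 := ℂ), norm_smul, norm_smul, hu, hv, hin]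
    have : RCLike.re (inner ℂ (v • x) z) ≤ ‖inner ℂ x z‖ := by
      refine (RCLike.re_le_norm _).trans_eq ?_
      rw [inner_smul_left, norm_mul]
      simp [hv]
    have h2 : RCLike.re ((‖inner ℂ x z‖ : ℂ)) = ‖inner ℂ x z‖ := by simp
    rw [h2]
    linarith
  · rw [inner_sub_right, hin, inner_self_eq_norm_sq_to_K]
    norm_cast
    change ((‖inner ℂ x z‖ : ℂ) - ((‖u • x‖ ^ 2 : ℝ) : ℂ)).im = 0
    rw [← Complex.ofReal_sub, Complex.ofReal_im]

/-! ### The curvature inequality for a single sample -/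

/-- The normalisation is |G| = 1, with u = Re(conj(G) w) and s = |w|². The right side is the
noiseless contribution of one sample; it can be negative only for u between -s and -s/2, and the
loss there is what fixes γ = (1+α₂)/(4α₁). -/
lemma curvature_quotient_normalized {s u b α₁ α₂ : ℝ} (hα₁ : 0 < α₁) (hα₂ : α₁ ≤ α₂)
    (hs : 0 ≤ s) (hus : u ^ 2 ≤ s) (hb₁ : α₁ ≤ b) (hb₂ : b ≤ α₂) :
    (u ^ 2 - (1 + (1 + α₂) / (4 * α₁)) * (s * min s 1)) / (1 + α₂)
      ≤ (2 * u + s) * (u + s) / (1 + 2 * u + s + b) := by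
  set γ := (1 + α₂) / (4 * α₁) with hγ
  have hγ4 : 1 / 4 ≤ γ := by rw [hγ, div_le_div_iff₀ (by norm_num) (by positivity)]; linarith
  have hV : 0 < 1 + α₂ := by linarith
  have hD0 : 0 ≤ 1 + 2 * u + s := by nlinarith [sq_nonneg (1 + u)]
  have hD : 0 < 1 + 2 * u + s + b := by linarith
  rcases lt_or_ge ((2 * u + s) * (u + s)) 0 with hN | hN
  -- A negative product places -u between s/2 and s.
  · have hus' : u ^ 2 ≤ s ^ 2 := by nlinarith
    have h1 : -(γ * u ^ 2) / (1 + α₂) ≤ (2 * u + s) * (u + s) / (1 + 2 * u + s + b) := by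
      have h2 : γ / (1 + α₂) = 1 / (4 * α₁) := by rw [hγ]; field_simp
      have h3 : -(γ * u ^ 2) / (1 + α₂) = -(u ^ 2 / 4) / α₁ := by
        rw [neg_div, mul_div_right_comm, h2]; field_simp
      rw [h3, div_le_div_iff₀ hα₁ hD]
      -- The numerator equals (s + 3u/2)² - u²/4, and the denominator is at least b ≥ α₁.
      nlinarith [sq_nonneg (s + 3 * u / 2), mul_nonneg (sq_nonneg u) hD0,
        mul_nonneg (sq_nonneg u) (sub_nonneg.2 hb₁)]
    refine le_trans ?_ h1
    gcongr
    rcases le_total s 1 with h | h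
    · rw [min_eq_left h]; nlinarith
    · rw [min_eq_right h]; nlinarith
  · rcases le_or_gt (u ^ 2 - (1 + γ) * (s * min s 1)) 0 with hR | hR
    · exact (div_nonpos_of_nonpos_of_nonneg hR hV.le).trans (div_nonneg hN hD.le)
    have hs1 : s < 1 := by
      by_contra h
      rw [min_eq_right (not_lt.1 h)] at hR
      nlinarith
    rw [min_eq_left hs1.le] at hR ⊢
    have hD' : 1 + 2 * u + s + b ≤ (1 + α₂) + (2 * u + s) := by linarith
    refine le_trans ?_ (div_le_div_of_nonneg_left hN hD hD')
    rw [div_le_div_iff₀ hV (by linarith)]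
    have hsu : s ^ 2 < u ^ 2 := by nlinarith
    -- For u ≤ 0 the extra term 2u + s is negative and can be dropped; what remains is (u + 3s/2)² +
    -- (γ - 1/4)s² ≥ 0. For u ≥ 0 it is absorbed using u² ≤ s and u ≤ 1.
    rcases le_total u 0 with hu | hu
    · have h1 : s < -u := by nlinarith
      have h2 : (u ^ 2 - (1 + γ) * (s * s)) * (1 + α₂ + (2 * u + s))
          ≤ (u ^ 2 - (1 + γ) * (s * s)) * (1 + α₂) := by
        apply mul_le_mul_of_nonneg_left _ hR.le
        linarith
      refine h2.trans (mul_le_mul_of_nonneg_right ?_ hV.le)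
      nlinarith [sq_nonneg (u + 3 / 2 * s), mul_nonneg (sub_nonneg.2 hγ4) (sq_nonneg s)]
    · have h2 : (u ^ 2 - (1 + γ) * (s * s)) * (1 + α₂ + (2 * u + s))
          ≤ u ^ 2 * (1 + α₂ + (2 * u + s)) := by
        apply mul_le_mul_of_nonneg_right _ (by linarith)
        have : 0 ≤ (1 + γ) * (s * s) := by positivity
        linarith
      refine h2.trans ?_
      have hu1 : u ≤ 1 := by nlinarith
      have h3 : u * (2 * u + s) ≤ (1 + α₂) * (u + 3 * s) := by nlinarith
      nlinarith [mul_le_mul_of_nonneg_left h3 hu, mul_nonneg hV.le (sq_nonneg s)]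

lemma curvature_quotient {X s u b α₁ α₂ : ℝ} (hα₁ : 0 < α₁) (hα₂ : α₁ ≤ α₂) (hX : 0 < X)
    (hs : 0 ≤ s) (hus : u ^ 2 ≤ X * s) (hb₁ : α₁ * X ≤ b) (hb₂ : b ≤ α₂ * X) :
    (u ^ 2 / X - (1 + (1 + α₂) / (4 * α₁)) * (s * min (s / X) 1)) / (1 + α₂)
      ≤ (2 * u + s) * (u + s) / (X + 2 * u + s + b) := by
  have hV : 0 < 1 + α₂ := by linarith
  have key := curvature_quotient_normalized (s := s / X) (u := u / X) (b := b / X) hα₁ hα₂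
    (by positivity) (by rw [div_pow, div_le_div_iff₀ (by positivity) hX]; nlinarith)
    (by rwa [le_div_iff₀ hX]) (by rwa [div_le_iff₀ hX])
  have e1 : 1 + 2 * (u / X) + s / X + b / X = (X + 2 * u + s + b) / X := by field_simp
  have e2 : (2 * (u / X) + s / X) * (u / X + s / X) = (2 * u + s) * (u + s) / X ^ 2 := by
    field_simp
  rw [e1, e2] at key
  calc _ = X * (((u / X) ^ 2 - (1 + (1 + α₂) / (4 * α₁)) * (s / X * min (s / X) 1)) / (1 + α₂)) := by
        generalize (1 + (1 + α₂) / (4 * α₁)) = β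
        generalize min (s / X) 1 = t
        field_simp
    _ ≤ _ := mul_le_mul_of_nonneg_left key hX.le
    _ = _ := by field_simp

lemma curvMinorant_le_norm_sq {β κ : ℝ} (hβ : 0 ≤ β) (hκ : 0 ≤ κ) (g w : ℂ) :
    curvMinorant β κ g w ≤ ‖w‖ ^ 2 := by
  unfold curvMinorant
  have h1 : ((starRingEnd ℂ (unitPhase g) * w).re) ^ 2 ≤ ‖w‖ ^ 2 := by
    rw [← sq_abs]
    gcongr
    refine (Complex.abs_re_le_norm _).trans_eq ?_
    simp [norm_unitPhase]
  have h2 : 0 ≤ min (κ * (‖w‖ ^ 2 / ‖g‖ ^ 2)) 1 := by positivity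
  have : 0 ≤ β * (‖w‖ ^ 2 * min (κ * (‖w‖ ^ 2 / ‖g‖ ^ 2)) 1) := by positivity
  linarith

/-- This is where κ = ρ² originates: normalising g by N = ‖x‖ and w by r = ‖h‖ multiplies |w|²/|g|²
by (N/r)², and ρN/r ≥ 1. The unimodular u is moved from g to w so that the reference direction stays
x. -/
lemma curvMinorant_rescaled_le {β ρ N r : ℝ} (hβ : 0 ≤ β) (hN : 0 < N) (hr : 0 < r)
    (hrN : r ≤ ρ * N) {g w u : ℂ} (hg : g ≠ 0) (hu : ‖u‖ = 1) :
    r ^ 2 * curvMinorant β (ρ ^ 2) ((N⁻¹ : ℂ) * g) ((r⁻¹ : ℂ) * (starRingEnd ℂ u * w))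
      ≤ ((starRingEnd ℂ (u * g) * w).re) ^ 2 / ‖g‖ ^ 2
        - β * (‖w‖ ^ 2 * min (‖w‖ ^ 2 / ‖g‖ ^ 2) 1) := by
  have hg' : 0 < ‖g‖ := norm_pos_iff.2 hg
  have hNC : (N : ℂ) ≠ 0 := by exact_mod_cast hN.ne'
  have hrC : (r : ℂ) ≠ 0 := by exact_mod_cast hr.ne'
  have hgC : (‖g‖ : ℂ) ≠ 0 := by exact_mod_cast hg'.ne'
  have hphase : unitPhase ((N⁻¹ : ℂ) * g) = g / ‖g‖ := by
    unfold unitPhase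
    rw [if_neg (mul_ne_zero (inv_ne_zero hNC) hg), norm_mul, norm_inv, Complex.norm_real,
      Real.norm_of_nonneg hN.le]
    push_cast
    field_simp
  have hw : ‖(r⁻¹ : ℂ) * (starRingEnd ℂ u * w)‖ = ‖w‖ / r := by
    rw [norm_mul, norm_mul, RCLike.norm_conj, hu, norm_inv, Complex.norm_real,
      Real.norm_of_nonneg hr.le]
    ring
  have hg2 : ‖(N⁻¹ : ℂ) * g‖ = ‖g‖ / N := by
    rw [norm_mul, norm_inv, Complex.norm_real, Real.norm_of_nonneg hN.le]
    ring
  have hre : (starRingEnd ℂ (g / ‖g‖) * ((r⁻¹ : ℂ) * (starRingEnd ℂ u * w))).re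
      = (starRingEnd ℂ (u * g) * w).re / (‖g‖ * r) := by
    have : starRingEnd ℂ (g / ‖g‖) * ((r⁻¹ : ℂ) * (starRingEnd ℂ u * w))
        = starRingEnd ℂ (u * g) * w / ((‖g‖ * r : ℝ) : ℂ) := by
      rw [map_div₀, Complex.conj_ofReal, map_mul]
      push_cast
      field_simp
    rw [this, Complex.div_ofReal_re]
  unfold curvMinorant
  rw [hphase, hw, hg2, hre, mul_sub]
  have hmin : min (‖w‖ ^ 2 / ‖g‖ ^ 2) 1 ≤ min (ρ ^ 2 * ((‖w‖ / r) ^ 2 / (‖g‖ / N) ^ 2)) 1 := by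
    refine min_le_min_right 1 ?_
    have : ρ ^ 2 * ((‖w‖ / r) ^ 2 / (‖g‖ / N) ^ 2)
        = ((ρ * N) ^ 2 / r ^ 2) * (‖w‖ ^ 2 / ‖g‖ ^ 2) := by field_simp
    rw [this]
    refine le_mul_of_one_le_left (by positivity) ?_
    rw [one_le_div (by positivity)]
    gcongr
  have e1 : r ^ 2 * ((starRingEnd ℂ (u * g) * w).re / (‖g‖ * r)) ^ 2
      = ((starRingEnd ℂ (u * g) * w).re) ^ 2 / ‖g‖ ^ 2 := by field_simp
  rw [e1]
  refine sub_le_sub_left ?_ _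
  calc β * (‖w‖ ^ 2 * min (‖w‖ ^ 2 / ‖g‖ ^ 2) 1)
      ≤ β * (‖w‖ ^ 2 * min (ρ ^ 2 * ((‖w‖ / r) ^ 2 / (‖g‖ / N) ^ 2)) 1) := by gcongr
    _ = _ := by field_simp

/-! ### Regular samples and the averaged synthesis operator -/

/-- The sampling vectors satisfy the upper frame bound `D`, and the averaged curvature minorant
along every unit direction which is aligned with `e` is at least `lam`. -/
structure IsRegular {n m : ℕ} (a : Fin m → Vec n) (e : Vec n) (D lam β κ : ℝ) : Prop where
  upper : ∀ h, ∑ j, ‖inner ℂ (a j) h‖ ^ 2 ≤ m * (D * ‖h‖ ^ 2)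
  lower : ∀ h, ‖h‖ = 1 → (inner ℂ e h).im = 0 →
    m * lam ≤ ∑ j, curvMinorant β κ (inner ℂ (a j) e) (inner ℂ (a j) h)

/-- The averaged synthesis operator `c ↦ (1/m) ∑ⱼ cⱼ aⱼ`. -/
def frameAvg {n m : ℕ} (a : Fin m → Vec n) (c : Fin m → ℂ) : Vec n :=
  (1 / (m : ℝ)) • ∑ j, c j • a j

lemma frameAvg_sub {n m : ℕ} (a : Fin m → Vec n) (c d : Fin m → ℂ) :
    frameAvg a (fun j => c j - d j) = frameAvg a c - frameAvg a d := by
  simp only [frameAvg, sub_smul, Finset.sum_sub_distrib, smul_sub]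

lemma re_inner_frameAvg {n m : ℕ} (a : Fin m → Vec n) (c : Fin m → ℂ) (h : Vec n) :
    RCLike.re (inner ℂ h (frameAvg a c))
      = (∑ j, (starRingEnd ℂ (inner ℂ (a j) h) * c j).re) / m := by
  have : inner ℂ h (frameAvg a c)
      = ((1 / (m : ℝ) : ℝ) : ℂ) * ∑ j, starRingEnd ℂ (inner ℂ (a j) h) * c j := by
    rw [frameAvg, ← Complex.coe_smul, inner_smul_right, inner_sum]
    congr 1
    refine Finset.sum_congr rfl fun j _ => ?_
    rw [inner_smul_right, inner_conj_symm, mul_comm]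
  rw [this]
  change (_ * _ : ℂ).re = _
  rw [Complex.re_ofReal_mul, Complex.re_sum]
  ring

section Frame

variable {n m : ℕ} {a : Fin m → Vec n} {e : Vec n} {D lam β κ : ℝ}

/-- Duality: test the synthesised vector v against itself, apply Cauchy–Schwarz over the samples,
then the upper frame bound at v. -/
lemma IsRegular.norm_frameAvg_sq_le (hreg : IsRegular a e D lam β κ) (hD : 0 ≤ D)
    (hm : 0 < m) (c : Fin m → ℂ) : ‖frameAvg a c‖ ^ 2 ≤ D * ((∑ j, ‖c j‖ ^ 2) / m) := by
  have hm' : (0 : ℝ) < m := by exact_mod_cast hm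
  set v := frameAvg a c
  have h1 : ‖v‖ ^ 2 ≤ (∑ j, ‖inner ℂ (a j) v‖ * ‖c j‖) / m := by
    rw [← inner_self_eq_norm_sq (𝕜 := ℂ), re_inner_frameAvg]
    gcongr with j
    refine (Complex.re_le_norm _).trans_eq ?_
    rw [norm_mul, RCLike.norm_conj]
  have hv := hreg.upper v
  have h2 := Finset.sum_mul_sq_le_sq_mul_sq Finset.univ (fun j => ‖inner ℂ (a j) v‖)
    (fun j => ‖c j‖)
  have h3 : (‖v‖ ^ 2) ^ 2 ≤ ‖v‖ ^ 2 * (D * ((∑ j, ‖c j‖ ^ 2) / m)) := by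
    calc (‖v‖ ^ 2) ^ 2 ≤ ((∑ j, ‖inner ℂ (a j) v‖ * ‖c j‖) / m) ^ 2 := by gcongr
      _ ≤ ((m * (D * ‖v‖ ^ 2)) * ∑ j, ‖c j‖ ^ 2) / m ^ 2 := by
        rw [div_pow]
        gcongr
        exact h2.trans (mul_le_mul_of_nonneg_right hv (by positivity))
      _ = _ := by field_simp
  rcases (sq_nonneg ‖v‖).eq_or_lt' with h0 | h0
  · rw [h0]
    positivity
  · nlinarith

end Frame

/-! ### Coefficients of the gradient and their deterministic bounds -/

/-- The noiseless gradient coefficient of one sample, with `G = a^* x` and `Z = a^* z`. -/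
def signalCoeff (b : ℝ) (G Z : ℂ) : ℂ := (((‖Z‖ ^ 2 - ‖G‖ ^ 2) / (‖Z‖ ^ 2 + b) : ℝ) : ℂ) * Z

lemma norm_add_sq_complex (G w : ℂ) :
    ‖G + w‖ ^ 2 = ‖G‖ ^ 2 + 2 * (starRingEnd ℂ G * w).re + ‖w‖ ^ 2 := by
  simp only [← Complex.normSq_eq_norm_sq, Complex.normSq_apply, Complex.add_re, Complex.add_im,
    Complex.mul_re, Complex.conj_re, Complex.conj_im]
  ring

lemma curvature_coeff {α₁ α₂ b : ℝ} (hα₁ : 0 < α₁) (hα₂ : α₁ ≤ α₂) {G : ℂ} (hG : G ≠ 0) (w : ℂ)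
    (hb₁ : α₁ * ‖G‖ ^ 2 ≤ b) (hb₂ : b ≤ α₂ * ‖G‖ ^ 2) :
    ((starRingEnd ℂ G * w).re ^ 2 / ‖G‖ ^ 2
        - (1 + (1 + α₂) / (4 * α₁)) * (‖w‖ ^ 2 * min (‖w‖ ^ 2 / ‖G‖ ^ 2) 1)) / (1 + α₂)
      ≤ (starRingEnd ℂ w * signalCoeff b G (G + w)).re := by
  have hG' : 0 < ‖G‖ := norm_pos_iff.2 hG
  have hus : (starRingEnd ℂ G * w).re ^ 2 ≤ ‖G‖ ^ 2 * ‖w‖ ^ 2 := by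
    rw [← sq_abs, ← mul_pow]
    gcongr
    refine (Complex.abs_re_le_norm _).trans_eq ?_
    rw [norm_mul, RCLike.norm_conj]
  refine (curvature_quotient hα₁ hα₂ (by positivity : 0 < ‖G‖ ^ 2) (sq_nonneg ‖w‖) hus hb₁
    hb₂).trans_eq ?_
  have h1 : (starRingEnd ℂ w * (G + w)).re = (starRingEnd ℂ G * w).re + ‖w‖ ^ 2 := by
    simp only [← Complex.normSq_eq_norm_sq, Complex.normSq_apply, Complex.add_re, Complex.add_im,
      Complex.mul_re, Complex.conj_re, Complex.conj_im]
    ring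
  unfold signalCoeff
  rw [mul_left_comm, Complex.re_ofReal_mul, h1, norm_add_sq_complex]
  ring

lemma div_sq_add_le {t b k : ℝ} (hk : 0 < k) (hb : k ^ 2 ≤ b) : t / (t ^ 2 + b) ≤ 1 / (2 * k) := by
  have : 0 < t ^ 2 + b := by nlinarith [sq_nonneg t, pow_pos hk 2]
  rw [div_le_div_iff₀ this (by positivity)]
  nlinarith [sq_nonneg (t - k)]

/-- Factor |Z|² - |G|² as (|Z| - |G|)(|Z| + |G|). The first factor is at most |w| in modulus. In the
rest, |Z|²/(|Z|²+b) ≤ 1, and the cross term |G||Z|/(|Z|²+b) is at most 1/(2√α₁) by AM–GM. -/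
lemma norm_signalCoeff_le {α₁ b : ℝ} (hα₁ : 0 < α₁) {G : ℂ} (hG : G ≠ 0) (w : ℂ)
    (hb₁ : α₁ * ‖G‖ ^ 2 ≤ b) : ‖signalCoeff b G (G + w)‖ ≤ uSmo α₁ * ‖w‖ := by
  have hG' : 0 < ‖G‖ := norm_pos_iff.2 hG
  have hb : 0 < b := lt_of_lt_of_le (by positivity) hb₁
  set Z := G + w
  have hD : 0 < ‖Z‖ ^ 2 + b := by positivity
  have hw : |‖Z‖ - ‖G‖| ≤ ‖w‖ := by
    have := abs_norm_sub_norm_le Z G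
    simpa [Z] using this
  have hk := div_sq_add_le (t := ‖Z‖) (k := √α₁ * ‖G‖) (b := b) (by positivity)
    (by rw [mul_pow, Real.sq_sqrt hα₁.le]; exact hb₁)
  have h2 : (‖Z‖ + ‖G‖) * ‖Z‖ / (‖Z‖ ^ 2 + b) ≤ uSmo α₁ := by
    have e : (‖Z‖ + ‖G‖) * ‖Z‖ / (‖Z‖ ^ 2 + b)
        = ‖Z‖ ^ 2 / (‖Z‖ ^ 2 + b) + ‖G‖ * (‖Z‖ / (‖Z‖ ^ 2 + b)) := by field_simp
    rw [e, uSmo]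
    have h3 : ‖Z‖ ^ 2 / (‖Z‖ ^ 2 + b) ≤ 1 := by rw [div_le_one hD]; linarith
    have h4 : ‖G‖ * (‖Z‖ / (‖Z‖ ^ 2 + b)) ≤ ‖G‖ * (1 / (2 * (√α₁ * ‖G‖))) := by gcongr
    have h5 : ‖G‖ * (1 / (2 * (√α₁ * ‖G‖))) = 1 / (2 * √α₁) := by field_simp
    linarith
  unfold signalCoeff
  rw [norm_mul, Complex.norm_real, Real.norm_eq_abs, abs_div, abs_of_pos hD]
  have h6 : |‖Z‖ ^ 2 - ‖G‖ ^ 2| = |‖Z‖ - ‖G‖| * (‖Z‖ + ‖G‖) := by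
    rw [show ‖Z‖ ^ 2 - ‖G‖ ^ 2 = (‖Z‖ - ‖G‖) * (‖Z‖ + ‖G‖) by ring, abs_mul,
      abs_of_nonneg (by positivity : 0 ≤ ‖Z‖ + ‖G‖)]
  calc |‖Z‖ ^ 2 - ‖G‖ ^ 2| / (‖Z‖ ^ 2 + b) * ‖Z‖
      = |‖Z‖ - ‖G‖| * ((‖Z‖ + ‖G‖) * ‖Z‖ / (‖Z‖ ^ 2 + b)) := by rw [h6]; ring
    _ ≤ ‖w‖ * uSmo α₁ := by gcongr
    _ = _ := mul_comm _ _

section Frame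

variable {n m : ℕ} {a : Fin m → Vec n} {x : Vec n} {D lam ρ α₁ α₂ : ℝ}

/-- A lower frame bound in every direction comes for free: the minorant is at most |w|², and
rotating z by a phase aligns it with e without changing any |a_j^* z|. -/
lemma IsRegular.frame_lower {β κ : ℝ} {e : Vec n} (hreg : IsRegular a e D lam β κ) (hβ : 0 ≤ β)
    (hκ : 0 ≤ κ) (z : Vec n) : m * (lam * ‖z‖ ^ 2) ≤ ∑ j, ‖inner ℂ (a j) z‖ ^ 2 := by
  rcases eq_or_ne z 0 with rfl | hz
  · simp
  have hz' : 0 < ‖z‖ := norm_pos_iff.2 hz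
  have hzC : (‖z‖ : ℂ) ≠ 0 := by exact_mod_cast hz'.ne'
  obtain ⟨u, hu, huw⟩ := exists_phase_mul_eq_norm (inner ℂ e z)
  have h1 : ‖((‖z‖⁻¹ : ℂ) * starRingEnd ℂ u) • z‖ = 1 := by
    rw [norm_smul, norm_mul, RCLike.norm_conj, hu, norm_inv, Complex.norm_real, norm_norm]
    field_simp
  have h2 : (inner ℂ e (((‖z‖⁻¹ : ℂ) * starRingEnd ℂ u) • z)).im = 0 := by
    rw [inner_smul_right, mul_assoc, huw, ← Complex.ofReal_inv, ← Complex.ofReal_mul,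
      Complex.ofReal_im]
  have h3 := hreg.lower _ h1 h2
  have h4 : m * lam ≤ ∑ j, ‖inner ℂ (a j) z‖ ^ 2 / ‖z‖ ^ 2 := by
    refine h3.trans (Finset.sum_le_sum fun j _ => ?_)
    refine (curvMinorant_le_norm_sq hβ hκ _ _).trans_eq ?_
    rw [inner_smul_right, norm_mul, norm_mul, RCLike.norm_conj, hu, norm_inv, Complex.norm_real,
      norm_norm]
    field_simp
  rw [← Finset.sum_div, le_div_iff₀ (by positivity)] at h4
  linarith

/-- Regularity is applied to the unit vector obtained from h by normalising and rotating by conj(u);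
it is aligned with x/‖x‖ exactly because h is aligned with u x. -/
lemma IsRegular.curvature (hα₁ : 0 < α₁) (hα₂ : α₁ ≤ α₂) (hx : x ≠ 0)
    (hreg : IsRegular a ((‖x‖⁻¹ : ℂ) • x) D lam (1 + (1 + α₂) / (4 * α₁)) (ρ ^ 2))
    {u : ℂ} (hu : ‖u‖ = 1) {h : Vec n} (hh : ‖h‖ ≤ ρ * ‖x‖) (him : (inner ℂ (u • x) h).im = 0)
    (hax : ∀ j, inner ℂ (a j) x ≠ 0) {b : Fin m → ℝ}
    (hb : ∀ j, α₁ * ‖inner ℂ (a j) x‖ ^ 2 ≤ b j ∧ b j ≤ α₂ * ‖inner ℂ (a j) x‖ ^ 2) :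
    m * (lam / (1 + α₂) * ‖h‖ ^ 2) ≤
      ∑ j, (starRingEnd ℂ (inner ℂ (a j) h) *
        signalCoeff (b j) (inner ℂ (a j) (u • x)) (inner ℂ (a j) (u • x + h))).re := by
  rcases eq_or_ne h 0 with rfl | hh0
  · simp
  have hh' : 0 < ‖h‖ := norm_pos_iff.2 hh0
  have hx' : 0 < ‖x‖ := norm_pos_iff.2 hx
  set β := 1 + (1 + α₂) / (4 * α₁) with hβdef
  have hβ : 0 ≤ β := by have : 0 < α₂ := by linarith
                        positivity
  have hV : 0 < 1 + α₂ := by linarith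
  have h1 : ‖((‖h‖⁻¹ : ℂ) * starRingEnd ℂ u) • h‖ = 1 := by
    rw [norm_smul, norm_mul, RCLike.norm_conj, hu, norm_inv, Complex.norm_real, norm_norm]
    field_simp
  have h2 : (inner ℂ ((‖x‖⁻¹ : ℂ) • x) (((‖h‖⁻¹ : ℂ) * starRingEnd ℂ u) • h)).im = 0 := by
    rw [inner_smul_left] at him
    rw [inner_smul_left, inner_smul_right, map_inv₀, Complex.conj_ofReal, mul_assoc,
      ← mul_assoc (_⁻¹), ← Complex.ofReal_inv, ← Complex.ofReal_inv, ← Complex.ofReal_mul,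
      Complex.im_ofReal_mul, him, mul_zero]
  have h3 := hreg.lower _ h1 h2
  have h4 : ∀ j, ‖h‖ ^ 2 / (1 + α₂) * curvMinorant β (ρ ^ 2) (inner ℂ (a j) ((‖x‖⁻¹ : ℂ) • x))
      (inner ℂ (a j) (((‖h‖⁻¹ : ℂ) * starRingEnd ℂ u) • h)) ≤
      (starRingEnd ℂ (inner ℂ (a j) h) *
        signalCoeff (b j) (inner ℂ (a j) (u • x)) (inner ℂ (a j) (u • x + h))).re := by
    intro j
    have hu0 : u ≠ 0 := by rintro rfl; simp at hu
    have hG : inner ℂ (a j) (u • x) = u * inner ℂ (a j) x := inner_smul_right _ _ _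
    have hGn : ‖u * inner ℂ (a j) x‖ = ‖inner ℂ (a j) x‖ := by rw [norm_mul, hu, one_mul]
    rw [inner_add_right, hG]
    refine le_trans ?_ (curvature_coeff hα₁ hα₂ (mul_ne_zero hu0 (hax j)) _
      (by rw [hGn]; exact (hb j).1) (by rw [hGn]; exact (hb j).2))
    rw [hGn, inner_smul_right, inner_smul_right, mul_assoc, div_mul_eq_mul_div]
    gcongr
    exact curvMinorant_rescaled_le hβ hx' hh' hh (hax j) hu
  refine le_trans ?_ (Finset.sum_le_sum fun j _ => h4 j)
  rw [← Finset.mul_sum]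
  calc m * (lam / (1 + α₂) * ‖h‖ ^ 2) = ‖h‖ ^ 2 / (1 + α₂) * (m * lam) := by ring
    _ ≤ _ := by gcongr

/-- The noise part of the Wirtinger gradient, as a coefficient vector. -/
def noiseCoeff (b η : ℝ) (Z : ℂ) : ℂ := ((η / (‖Z‖ ^ 2 + b) : ℝ) : ℂ) * Z

/-- The bounded part of the Wirtinger gradient, as a coefficient. -/
def dataCoeff (b : ℝ) (G Z : ℂ) : ℂ := (((‖G‖ ^ 2 + b) / (‖Z‖ ^ 2 + b) : ℝ) : ℂ) * Z

/-- The splitting used near the signal. The phase u is free because only |a_j^* x| enters. -/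
lemma wfGrad_eq_signal_sub_noise (x z : Vec n) {b : Fin m → ℝ} (η : Fin m → ℝ)
    (hb : ∀ j, 0 < b j) {u : ℂ} (hu : ‖u‖ = 1) :
    wfGrad a (noisyMeas a x b η) b z =
      frameAvg a (fun j => signalCoeff (b j) (inner ℂ (a j) (u • x)) (inner ℂ (a j) z))
        - frameAvg a (fun j => noiseCoeff (b j) (η j) (inner ℂ (a j) z)) := by
  rw [← frameAvg_sub, wfGrad, frameAvg]
  congr 1
  refine Finset.sum_congr rfl fun j _ => ?_
  rw [← Complex.coe_smul, smul_smul]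
  congr 1
  have hD : ‖inner ℂ (a j) z‖ ^ 2 + b j ≠ 0 := by have := hb j; positivity
  rw [signalCoeff, noiseCoeff, noisyMeas, inner_smul_right, norm_mul, hu, one_mul, ← sub_mul,
    ← Complex.ofReal_sub]
  congr 2
  field_simp
  ring

/-- The splitting used far from the signal: the Gram operator acts linearly on z, and the other two
terms are bounded independently of z. -/
lemma wfGrad_eq_gram_sub (x z : Vec n) {b : Fin m → ℝ} (η : Fin m → ℝ)
    (hb : ∀ j, 0 < b j) :
    wfGrad a (noisyMeas a x b η) b z =
      frameAvg a (fun j => inner ℂ (a j) z)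
        - frameAvg a (fun j => dataCoeff (b j) (inner ℂ (a j) x) (inner ℂ (a j) z))
        - frameAvg a (fun j => noiseCoeff (b j) (η j) (inner ℂ (a j) z)) := by
  rw [← frameAvg_sub, ← frameAvg_sub, wfGrad, frameAvg]
  congr 1
  refine Finset.sum_congr rfl fun j _ => ?_
  rw [← Complex.coe_smul, smul_smul]
  congr 1
  have hD : ‖inner ℂ (a j) z‖ ^ 2 + b j ≠ 0 := by have := hb j; positivity
  rw [dataCoeff, noiseCoeff, noisyMeas, ← one_sub_mul, ← sub_mul,
    ← Complex.ofReal_one, ← Complex.ofReal_sub, ← Complex.ofReal_sub]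
  congr 2
  field_simp
  ring

lemma norm_noiseCoeff_le {b k : ℝ} (hk : 0 < k) (hb : k ^ 2 ≤ b) (η : ℝ) (Z : ℂ) :
    ‖noiseCoeff b η Z‖ ≤ |η| / (2 * k) := by
  have hD : 0 < ‖Z‖ ^ 2 + b := by nlinarith [sq_nonneg ‖Z‖, pow_pos hk 2]
  rw [noiseCoeff, norm_mul, Complex.norm_real, Real.norm_eq_abs, abs_div, abs_of_pos hD]
  calc _ = |η| * (‖Z‖ / (‖Z‖ ^ 2 + b)) := by ring
    _ ≤ |η| * (1 / (2 * k)) := mul_le_mul_of_nonneg_left (div_sq_add_le hk hb) (abs_nonneg η)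
    _ = _ := by ring

lemma norm_dataCoeff_le {b : ℝ} (hα₁ : 0 < α₁) {G : ℂ} (hG : G ≠ 0) (Z : ℂ)
    (hb₁ : α₁ * ‖G‖ ^ 2 ≤ b) (hb₂ : b ≤ α₂ * ‖G‖ ^ 2) :
    ‖dataCoeff b G Z‖ ≤ (1 + α₂) / (2 * √α₁) * ‖G‖ := by
  have hG' : 0 < ‖G‖ := norm_pos_iff.2 hG
  have hb : 0 < b := lt_of_lt_of_le (by positivity) hb₁
  have hD : 0 < ‖Z‖ ^ 2 + b := by positivity
  have hk := div_sq_add_le (t := ‖Z‖) (k := √α₁ * ‖G‖) (b := b) (by positivity)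
    (by rw [mul_pow, Real.sq_sqrt hα₁.le]; exact hb₁)
  rw [dataCoeff, norm_mul, Complex.norm_real, Real.norm_of_nonneg (by positivity)]
  calc _ = (‖G‖ ^ 2 + b) * (‖Z‖ / (‖Z‖ ^ 2 + b)) := by ring
    _ ≤ ((1 + α₂) * ‖G‖ ^ 2) * (1 / (2 * (√α₁ * ‖G‖))) :=
      mul_le_mul (by linarith) hk (by positivity) (by nlinarith [sq_nonneg ‖G‖])
    _ = _ := by field_simp

end Frame

/-! ### One-step estimates and convergence on the regularity event -/

section Dynamics

variable {n m : ℕ} {a : Fin m → Vec n} {x : Vec n} {D lam ρ α₁ α₂ β κ : ℝ} {e : Vec n}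

lemma norm_sub_smul_sq (v g : Vec n) (μ : ℝ) :
    ‖v - μ • g‖ ^ 2 = ‖v‖ ^ 2 - 2 * μ * RCLike.re (inner ℂ v g) + μ ^ 2 * ‖g‖ ^ 2 := by
  rw [norm_sub_sq (𝕜 := ℂ), ← Complex.coe_smul, inner_smul_right, norm_smul, Complex.norm_real,
    mul_pow, Real.norm_eq_abs, sq_abs]
  change _ - 2 * (((μ : ℂ) * inner ℂ v g)).re + _ = _ - 2 * μ * (inner ℂ v g).re + _
  rw [Complex.re_ofReal_mul]
  ring

lemma IsRegular.norm_noise_le (hreg : IsRegular a e D lam β κ) (hD : 0 ≤ D) (hm : 0 < m)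
    {b : Fin m → ℝ} {k : ℝ} (hk : 0 < k) (hb : ∀ j, k ^ 2 ≤ b j)
    (η : EuclideanSpace ℝ (Fin m)) (z : Vec n) :
    ‖frameAvg a (fun j => noiseCoeff (b j) (η j) (inner ℂ (a j) z))‖
      ≤ √D / (2 * k) * (‖η‖ / √m) := by
  have hm' : (0 : ℝ) < m := by exact_mod_cast hm
  refine le_of_sq_le_sq ?_ (by positivity)
  refine (hreg.norm_frameAvg_sq_le hD hm _).trans ?_
  calc D * ((∑ j, ‖noiseCoeff (b j) (η j) (inner ℂ (a j) z)‖ ^ 2) / m)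
      ≤ D * ((∑ j, (|η j| / (2 * k)) ^ 2) / m) := by
        gcongr with j
        exact norm_noiseCoeff_le hk (hb j) _ _
    _ = D * ((‖η‖ ^ 2 / (2 * k) ^ 2) / m) := by
        simp only [div_pow, ← Finset.sum_div, EuclideanSpace.norm_sq_eq, Real.norm_eq_abs]
    _ = (√D / (2 * k) * (‖η‖ / √m)) ^ 2 := by
        simp only [mul_pow, div_pow, Real.sq_sqrt hD, Real.sq_sqrt hm'.le]
        field_simp

/-- One noiseless step contracts towards the aligned copy of the signal. -/
lemma IsRegular.norm_signal_step_le (hα₁ : 0 < α₁) (hα₂ : α₁ ≤ α₂) (hx : x ≠ 0) (hm : 0 < m)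
    (hreg : IsRegular a ((‖x‖⁻¹ : ℂ) • x) D lam (1 + (1 + α₂) / (4 * α₁)) (ρ ^ 2)) (hD : 0 ≤ D)
    {u : ℂ} (hu : ‖u‖ = 1) {z : Vec n} (hz : ‖z - u • x‖ ≤ ρ * ‖x‖)
    (him : (inner ℂ (u • x) (z - u • x)).im = 0)
    (hax : ∀ j, inner ℂ (a j) x ≠ 0) {b : Fin m → ℝ}
    (hb : ∀ j, α₁ * ‖inner ℂ (a j) x‖ ^ 2 ≤ b j ∧ b j ≤ α₂ * ‖inner ℂ (a j) x‖ ^ 2)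
    {μ q : ℝ} (hμ : 0 < μ) (hq : 0 ≤ q)
    (hμq : 1 - 2 * μ * (lam / (1 + α₂)) + (μ * (D * uSmo α₁)) ^ 2 ≤ q ^ 2) :
    ‖(z - u • x) - μ • frameAvg a
        (fun j => signalCoeff (b j) (inner ℂ (a j) (u • x)) (inner ℂ (a j) z))‖
      ≤ q * ‖z - u • x‖ := by
  have hm' : (0 : ℝ) < m := by exact_mod_cast hm
  obtain ⟨h, rfl⟩ : ∃ h, z = u • x + h := ⟨z - u • x, by abel⟩
  rw [add_sub_cancel_left] at hz him ⊢
  have hu0 : u ≠ 0 := by rintro rfl; simp at hu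
  refine le_of_sq_le_sq ?_ (by positivity)
  rw [norm_sub_smul_sq]
  set g := frameAvg a
        (fun j => signalCoeff (b j) (inner ℂ (a j) (u • x)) (inner ℂ (a j) (u • x + h)))
  have h1 : lam / (1 + α₂) * ‖h‖ ^ 2 ≤ RCLike.re (inner ℂ h g) := by
    rw [re_inner_frameAvg, le_div_iff₀ hm', mul_comm]
    exact hreg.curvature hα₁ hα₂ hx hu hz him hax hb
  have h2 : ‖g‖ ^ 2 ≤ (D * uSmo α₁) ^ 2 * ‖h‖ ^ 2 := by
    refine (hreg.norm_frameAvg_sq_le hD hm _).trans ?_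
    have h3 : ∑ j, ‖signalCoeff (b j) (inner ℂ (a j) (u • x)) (inner ℂ (a j) (u • x + h))‖ ^ 2
        ≤ uSmo α₁ ^ 2 * (m * (D * ‖h‖ ^ 2)) := by
      refine le_trans ?_ (mul_le_mul_of_nonneg_left (hreg.upper h) (sq_nonneg _))
      rw [Finset.mul_sum]
      refine Finset.sum_le_sum fun j _ => ?_
      rw [← mul_pow, inner_add_right, inner_smul_right]
      gcongr
      refine norm_signalCoeff_le hα₁ (mul_ne_zero hu0 (hax j)) _ ?_
      rw [norm_mul, hu, one_mul]
      exact (hb j).1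
    calc _ ≤ D * (uSmo α₁ ^ 2 * (m * (D * ‖h‖ ^ 2)) / m) := by gcongr
      _ = _ := by field_simp
  have h4 := mul_le_mul_of_nonneg_left h2 (sq_nonneg μ)
  have h5 := mul_le_mul_of_nonneg_left h1 (by positivity : 0 ≤ 2 * μ)
  have h6 := mul_le_mul_of_nonneg_right hμq (sq_nonneg ‖h‖)
  rw [mul_pow q]
  linarith

/-- The phase aligned with the old iterate is reused for the new one, which can only overestimate
its distance. Both argument orders are recorded: the induction runs on `phaseDist x z`, while the
final bound is on the reverse order. -/
lemma IsRegular.phaseDist_step_le (hα₁ : 0 < α₁) (hα₂ : α₁ ≤ α₂) (hx : x ≠ 0) (hm : 0 < m)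
    (hreg : IsRegular a ((‖x‖⁻¹ : ℂ) • x) D lam (1 + (1 + α₂) / (4 * α₁)) (ρ ^ 2)) (hD : 0 ≤ D)
    {z : Vec n} (hz : z ∈ nbhd x ρ) {b : Fin m → ℝ} {Cx : ℝ} (hCx : 0 < Cx)
    (hax : ∀ j, Cx * ‖x‖ ≤ ‖inner ℂ (a j) x‖)
    (hb : ∀ j, α₁ * ‖inner ℂ (a j) x‖ ^ 2 ≤ b j ∧ b j ≤ α₂ * ‖inner ℂ (a j) x‖ ^ 2)
    (η : EuclideanSpace ℝ (Fin m)) {μ q : ℝ} (hμ : 0 < μ) (hq : 0 ≤ q)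
    (hμq : 1 - 2 * μ * (lam / (1 + α₂)) + (μ * (D * uSmo α₁)) ^ 2 ≤ q ^ 2) :
    phaseDist x (z - μ • wfGrad a (noisyMeas a x b η) b z) ≤ q * phaseDist x z
        + μ * √D / (2 * √α₁ * Cx) * (‖η‖ / (√m * ‖x‖)) ∧
      phaseDist (z - μ • wfGrad a (noisyMeas a x b η) b z) x ≤ q * phaseDist x z
        + μ * √D / (2 * √α₁ * Cx) * (‖η‖ / (√m * ‖x‖)) := by
  have hx' : 0 < ‖x‖ := norm_pos_iff.2 hx
  have hax0 : ∀ j, inner ℂ (a j) x ≠ 0 := fun j =>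
    norm_pos_iff.1 (lt_of_lt_of_le (by positivity) (hax j))
  obtain ⟨u, hu, hdist, him⟩ := exists_phase_alignment x z
  have hk : 0 < √α₁ * (Cx * ‖x‖) := by positivity
  have hbk : ∀ j, (√α₁ * (Cx * ‖x‖)) ^ 2 ≤ b j := fun j => by
    rw [mul_pow, Real.sq_sqrt hα₁.le]
    refine le_trans ?_ (hb j).1
    gcongr
    exact hax j
  have hbpos : ∀ j, 0 < b j := fun j => lt_of_lt_of_le (by positivity) (hbk j)
  have hd : ‖z - u • x‖ = phaseDist x z := by rw [norm_sub_rev, hdist]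
  have h1 := hreg.norm_signal_step_le hα₁ hα₂ hx hm hD hu (z := z)
    (by rw [hd]; exact hz) him hax0 hb hμ hq hμq
  have h2 := hreg.norm_noise_le hD hm hk hbk η z
  have h3 : ‖u • x - (z - μ • wfGrad a (noisyMeas a x b η) b z)‖ ≤ q * phaseDist x z
        + μ * √D / (2 * √α₁ * Cx) * (‖η‖ / (√m * ‖x‖)) := by
    rw [wfGrad_eq_signal_sub_noise x z η hbpos hu, norm_sub_rev]
    set g := frameAvg a
        (fun j => signalCoeff (b j) (inner ℂ (a j) (u • x)) (inner ℂ (a j) z))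
    set r := frameAvg a (fun j => noiseCoeff (b j) (η j) (inner ℂ (a j) z))
    have e1 : z - μ • (g - r) - u • x = ((z - u • x) - μ • g) + μ • r := by
      rw [smul_sub]; abel
    rw [e1, ← hd]
    refine (norm_add_le _ _).trans (add_le_add h1 ?_)
    rw [norm_smul, Real.norm_of_nonneg hμ.le]
    calc μ * ‖r‖ ≤ μ * (√D / (2 * (√α₁ * (Cx * ‖x‖))) * (‖η‖ / √m)) := by gcongr
      _ = _ := by field_simp
  exact ⟨(phaseDist_le x _ hu).trans h3, (phaseDist_symm_le x _ hu).trans h3⟩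

/-- The iterates cannot blow up: one step is a contraction up to a bounded term. -/
lemma IsRegular.norm_step_le (hα₁ : 0 < α₁) (hα₂ : α₁ ≤ α₂) (hx : x ≠ 0) (hm : 0 < m)
    (hreg : IsRegular a e D lam β κ) (hβ : 0 ≤ β) (hκ : 0 ≤ κ) (hD : 0 ≤ D)
    (z : Vec n) {b : Fin m → ℝ} {Cx : ℝ} (hCx : 0 < Cx)
    (hax : ∀ j, Cx * ‖x‖ ≤ ‖inner ℂ (a j) x‖)
    (hb : ∀ j, α₁ * ‖inner ℂ (a j) x‖ ^ 2 ≤ b j ∧ b j ≤ α₂ * ‖inner ℂ (a j) x‖ ^ 2)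
    (η : EuclideanSpace ℝ (Fin m)) {μ p : ℝ} (hμ : 0 < μ) (hp : 0 ≤ p) (hμD : μ * D ≤ 2)
    (hμp : 1 - μ * (2 - μ * D) * lam ≤ p ^ 2) :
    ‖z - μ • wfGrad a (noisyMeas a x b η) b z‖ ≤ p * ‖z‖
        + (μ * D * ((1 + α₂) / (2 * √α₁)) * ‖x‖
          + μ * √D / (2 * √α₁ * Cx) * (‖η‖ / (√m * ‖x‖))) := by
  have hm' : (0 : ℝ) < m := by exact_mod_cast hm
  have hx' : 0 < ‖x‖ := norm_pos_iff.2 hx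
  have hax0 : ∀ j, inner ℂ (a j) x ≠ 0 := fun j =>
    norm_pos_iff.1 (lt_of_lt_of_le (by positivity) (hax j))
  have hk : 0 < √α₁ * (Cx * ‖x‖) := by positivity
  have hbk : ∀ j, (√α₁ * (Cx * ‖x‖)) ^ 2 ≤ b j := fun j => by
    rw [mul_pow, Real.sq_sqrt hα₁.le]
    refine le_trans ?_ (hb j).1
    gcongr
    exact hax j
  have hbpos : ∀ j, 0 < b j := fun j => lt_of_lt_of_le (by positivity) (hbk j)
  have h2 := hreg.norm_noise_le hD hm hk hbk η z
  rw [wfGrad_eq_gram_sub x z η hbpos]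
  set g := frameAvg a (fun j => inner ℂ (a j) z)
  set d := frameAvg a (fun j => dataCoeff (b j) (inner ℂ (a j) x) (inner ℂ (a j) z))
  set r := frameAvg a (fun j => noiseCoeff (b j) (η j) (inner ℂ (a j) z))
  -- Here Re⟨z, g⟩ = S, the mean of |a_j^* z|², and ‖g‖² ≤ D S. So ‖z‖² decreases by at least μ(2 -
  -- μD)S, and S ≥ lam‖z‖².
  have h3 : ‖z - μ • g‖ ≤ p * ‖z‖ := by
    refine le_of_sq_le_sq ?_ (by positivity)
    rw [norm_sub_smul_sq, re_inner_frameAvg]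
    have e1 : (∑ j, (starRingEnd ℂ (inner ℂ (a j) z) * inner ℂ (a j) z).re)
        = ∑ j, ‖inner ℂ (a j) z‖ ^ 2 := Finset.sum_congr rfl fun j _ => by
      rw [Complex.conj_mul', ← Complex.ofReal_pow, Complex.ofReal_re]
    rw [e1]
    have h4 : ‖g‖ ^ 2 ≤ D * ((∑ j, ‖inner ℂ (a j) z‖ ^ 2) / m) := hreg.norm_frameAvg_sq_le hD hm _
    have h5 : lam * ‖z‖ ^ 2 ≤ (∑ j, ‖inner ℂ (a j) z‖ ^ 2) / m := by
      rw [le_div_iff₀ hm', mul_comm]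
      exact hreg.frame_lower hβ hκ z
    set S := (∑ j, ‖inner ℂ (a j) z‖ ^ 2) / (m : ℝ)
    have h6 := mul_le_mul_of_nonneg_left h4 (sq_nonneg μ)
    have h7 := mul_le_mul_of_nonneg_left h5
      (mul_nonneg hμ.le (by linarith : 0 ≤ 2 - μ * D))
    have h8 := mul_le_mul_of_nonneg_right hμp (sq_nonneg ‖z‖)
    rw [mul_pow p]
    linarith
  have h4 : ‖d‖ ≤ D * ((1 + α₂) / (2 * √α₁)) * ‖x‖ := by
    have hc : 0 ≤ (1 + α₂) / (2 * √α₁) := by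
      have : 0 ≤ 1 + α₂ := by linarith
      positivity
    refine le_of_sq_le_sq ?_ (by positivity)
    refine (hreg.norm_frameAvg_sq_le hD hm _).trans ?_
    have h5 : ∑ j, ‖dataCoeff (b j) (inner ℂ (a j) x) (inner ℂ (a j) z)‖ ^ 2
        ≤ ((1 + α₂) / (2 * √α₁)) ^ 2 * (m * (D * ‖x‖ ^ 2)) := by
      refine le_trans ?_ (mul_le_mul_of_nonneg_left (hreg.upper x) (sq_nonneg _))
      rw [Finset.mul_sum]
      refine Finset.sum_le_sum fun j _ => ?_
      rw [← mul_pow]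
      gcongr
      exact norm_dataCoeff_le hα₁ (hax0 j) _ (hb j).1 (hb j).2
    calc _ ≤ D * (((1 + α₂) / (2 * √α₁)) ^ 2 * (m * (D * ‖x‖ ^ 2)) / m) := by gcongr
      _ = _ := by field_simp
  have e2 : z - μ • (g - d - r) = (z - μ • g) + (μ • d + μ • r) := by
    rw [smul_sub, smul_sub]; abel
  rw [e2]
  refine (norm_add_le _ _).trans (add_le_add h3 ((norm_add_le _ _).trans (add_le_add ?_ ?_)))
  · rw [norm_smul, Real.norm_of_nonneg hμ.le]
    calc μ * ‖d‖ ≤ μ * (D * ((1 + α₂) / (2 * √α₁)) * ‖x‖) := by gcongr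
      _ = _ := by ring
  · rw [norm_smul, Real.norm_of_nonneg hμ.le]
    calc μ * ‖r‖ ≤ μ * (√D / (2 * (√α₁ * (Cx * ‖x‖))) * (‖η‖ / √m)) := by gcongr
      _ = _ := by field_simp

lemma le_of_affine_recursion {d : ℕ → ℝ} {p R : ℝ} (hp : 0 ≤ p) (hp1 : p < 1) (hR : 0 ≤ R)
    (h0 : 0 ≤ d 0) (hd : ∀ k, d (k + 1) ≤ p * d k + R) (k : ℕ) : d k ≤ d 0 + R / (1 - p) := by
  have h1 : 0 < 1 - p := by linarith
  induction k with
  | zero => have : 0 ≤ R / (1 - p) := by positivity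
            linarith
  | succ k ih =>
    have e : R / (1 - p) = p * (R / (1 - p)) + R := by field_simp; ring
    have := mul_le_mul_of_nonneg_left ih hp
    have h2 : p * d 0 ≤ d 0 := mul_le_of_le_one_left h0 hp1.le
    linarith [hd k]

/-- Convergence up to the noise level on the regularity event. -/
theorem IsRegular.phaseDist_wfIter_le (hα₁ : 0 < α₁) (hα₂ : α₁ ≤ α₂) (hx : x ≠ 0) (hm : 0 < m)
    (hreg : IsRegular a ((‖x‖⁻¹ : ℂ) • x) D lam (1 + (1 + α₂) / (4 * α₁)) (ρ ^ 2)) (hD : 0 < D)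
    (hρ : 0 < ρ) (hρ1 : ρ ≤ 1) {b : Fin m → ℝ} {Cx : ℝ} (hCx : 0 < Cx)
    (hax : ∀ j, Cx * ‖x‖ ≤ ‖inner ℂ (a j) x‖)
    (hb : ∀ j, α₁ * ‖inner ℂ (a j) x‖ ^ 2 ≤ b j ∧ b j ≤ α₂ * ‖inner ℂ (a j) x‖ ^ 2)
    (η : EuclideanSpace ℝ (Fin m)) {μ p q : ℝ} (hμ : 0 < μ)
    (hp : 0 ≤ p) (hp1 : p < 1) (hμD : μ * D ≤ 2)
    (hμp : 1 - μ * (2 - μ * D) * lam ≤ p ^ 2) (hq : 0 ≤ q) (hq1 : q < 1)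
    (hμq : 1 - 2 * μ * (lam / (1 + α₂)) + (μ * (D * uSmo α₁)) ^ 2 ≤ q ^ 2)
    {z₀ : Vec n} (hz₀ : z₀ ∈ nbhd x ρ) (k : ℕ) :
    phaseDist (wfIter a (noisyMeas a x b η) b μ z₀ (k + 1)) x ≤
      (μ * √D / (2 * √α₁ * Cx)) * ((3 + μ * D * ((1 + α₂) / (2 * √α₁)) / (1 - p)) / ((1 - q) * ρ)
        + 1 / (1 - p) + 1 / (1 - q)) * (‖η‖ / (√m * ‖x‖)) + q ^ (k + 1) * ‖x‖ := by
  have hx' : 0 < ‖x‖ := norm_pos_iff.2 hx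
  set z := wfIter a (noisyMeas a x b η) b μ z₀ with hzdef
  have hz_succ : ∀ k, z (k + 1) = z k - μ • wfGrad a (noisyMeas a x b η) b (z k) := fun k => rfl
  set E := μ * √D / (2 * √α₁ * Cx) * (‖η‖ / (√m * ‖x‖)) with hE
  set M := μ * D * ((1 + α₂) / (2 * √α₁)) with hM
  have hE0 : 0 ≤ E := by positivity
  have hα₂0 : 0 < α₂ := by linarith
  have hM0 : 0 ≤ M := by positivity
  have hq' : 0 < 1 - q := by linarith
  have hp' : 0 < 1 - p := by linarith
  have hrhs : μ * √D / (2 * √α₁ * Cx) * ((3 + M / (1 - p)) / ((1 - q) * ρ)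
        + 1 / (1 - p) + 1 / (1 - q)) * (‖η‖ / (√m * ‖x‖))
      = E * ((3 + M / (1 - p)) / ((1 - q) * ρ)) + E / (1 - p) + E / (1 - q) := by
    rw [hE]; ring
  rw [hrhs]
  have hT1 : 0 ≤ E * ((3 + M / (1 - p)) / ((1 - q) * ρ)) := by positivity
  have hT2 : 0 ≤ E / (1 - p) := by positivity
  have hT3 : 0 ≤ E / (1 - q) := by positivity
  -- The threshold is exactly the noise level at which qρ‖x‖ + E ≤ ρ‖x‖, so that the neighbourhood
  -- is mapped into itself.
  rcases le_or_gt E ((1 - q) * (ρ * ‖x‖)) with hsmall | hbig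
  · have key : ∀ k, phaseDist x (z k) ≤ q ^ k * (ρ * ‖x‖) + E / (1 - q) ∧
        phaseDist x (z k) ≤ ρ * ‖x‖ := by
      intro k
      induction k with
      | zero =>
        refine ⟨?_, hz₀⟩
        have : phaseDist x (z 0) ≤ ρ * ‖x‖ := hz₀
        rw [pow_zero, one_mul]
        linarith
      | succ k ih =>
        have hstep := (hreg.phaseDist_step_le hα₁ hα₂ hx hm hD.le (z := z k) ih.2 hCx hax hb η hμ hq
          hμq).1
        rw [← hz_succ, ← hE] at hstep
        constructor
        · have h1 := mul_le_mul_of_nonneg_left ih.1 hq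
          have e1 : q * (q ^ k * (ρ * ‖x‖) + E / (1 - q)) + E
              = q ^ (k + 1) * (ρ * ‖x‖) + E / (1 - q) := by field_simp; ring
          linarith
        · have h1 := mul_le_mul_of_nonneg_left ih.2 hq
          linarith
    have hstep := (hreg.phaseDist_step_le hα₁ hα₂ hx hm hD.le (z := z k) (key k).2 hCx hax hb η hμ hq
          hμq).2
    rw [← hz_succ, ← hE] at hstep
    have h1 := mul_le_mul_of_nonneg_left (key k).1 hq
    have e1 : q * (q ^ k * (ρ * ‖x‖) + E / (1 - q)) + E
        = q ^ (k + 1) * (ρ * ‖x‖) + E / (1 - q) := by field_simp; ring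
    have h2 : q ^ (k + 1) * (ρ * ‖x‖) ≤ q ^ (k + 1) * ‖x‖ := by
      gcongr
      nlinarith
    linarith
  · have hrec := le_of_affine_recursion (d := fun k => ‖z k‖) hp hp1 (R := M * ‖x‖ + E)
      (by positivity) (norm_nonneg _)
      (fun k => hreg.norm_step_le hα₁ hα₂ hx hm (by positivity) (sq_nonneg ρ) hD.le (z k) hCx hax hb
        η hμ hp hμD hμp) (k + 1)
    obtain ⟨u, hu, hdist, -⟩ := exists_phase_alignment x z₀
    have hz0 : ‖z₀‖ ≤ 2 * ‖x‖ := by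
      have h1 : ‖z₀‖ ≤ ‖u • x‖ + ‖u • x - z₀‖ := by
        rw [norm_sub_rev]
        exact norm_le_norm_add_norm_sub' z₀ (u • x)
      rw [norm_smul, hu, one_mul, hdist] at h1
      have h2 : phaseDist x z₀ ≤ ρ * ‖x‖ := hz₀
      nlinarith
    have h3 : phaseDist (z (k + 1)) x ≤ ‖x‖ + ‖z (k + 1)‖ := by
      refine (phaseDist_symm_le x (z (k + 1)) (u := 1) (by simp)).trans ?_
      rw [one_smul]
      exact norm_sub_le _ _
    -- Large noise: the signal itself is of the order of the error. The factor 3 below collects ‖x‖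
    -- + ‖z₀‖ ≤ 3‖x‖.
    have h4 : ‖x‖ ≤ E / ((1 - q) * ρ) := by
      rw [le_div_iff₀ (by positivity)]
      linarith
    have h5 : ‖x‖ * (3 + M / (1 - p)) ≤ E / ((1 - q) * ρ) * (3 + M / (1 - p)) := by gcongr
    have h6 : 0 ≤ q ^ (k + 1) * ‖x‖ := by positivity
    have e1 : E * ((3 + M / (1 - p)) / ((1 - q) * ρ))
        = E / ((1 - q) * ρ) * (3 + M / (1 - p)) := by ring
    have e2 : (M * ‖x‖ + E) / (1 - p) = ‖x‖ * (M / (1 - p)) + E / (1 - p) := by ring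
    have hz00 : z 0 = z₀ := rfl
    simp only [hz00] at hrec
    linarith

end Dynamics

/-! ### Volumetric bounds for ε-nets -/

section Nets

open Module Metric
open scoped ENNReal Function

variable {E : Type*} [NormedAddCommGroup E] [NormedSpace ℝ E] [FiniteDimensional ℝ E]

/-- An `ε`-separated subset of the unit ball has at most `(1 + 2 / ε) ^ dim` elements. -/
lemma card_le_of_separated_unitBall {ε : ℝ} (hε : 0 < ε) (s : Finset E) (hs : ∀ c ∈ s, ‖c‖ ≤ 1)
    (h : ∀ c ∈ s, ∀ d ∈ s, c ≠ d → ε ≤ ‖c - d‖) : (s.card : ℝ) ≤ (1 + 2 / ε) ^ finrank ℝ E := by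
  borelize E
  let μ : Measure E := Measure.addHaar
  have hδ : 0 < ε / 2 := by positivity
  have hρ : 0 < 1 + ε / 2 := by positivity
  set A := ⋃ c ∈ s, ball (c : E) (ε / 2) with hA
  have D : Set.Pairwise (s : Set E) (Disjoint on fun c => ball (c : E) (ε / 2)) := by
    rintro c hc d hd hcd
    apply ball_disjoint_ball
    rw [dist_eq_norm]
    linarith [h c hc d hd hcd]
  have A_subset : A ⊆ ball (0 : E) (1 + ε / 2) := by
    refine Set.iUnion₂_subset fun x hx => ?_
    apply ball_subset_ball'
    rw [dist_zero_right]
    linarith [hs x hx]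
  have I :
    (s.card : ℝ≥0∞) * ENNReal.ofReal ((ε / 2) ^ finrank ℝ E) * μ (ball 0 1) ≤
      ENNReal.ofReal ((1 + ε / 2) ^ finrank ℝ E) * μ (ball 0 1) :=
    calc
      (s.card : ℝ≥0∞) * ENNReal.ofReal ((ε / 2) ^ finrank ℝ E) * μ (ball 0 1) = μ A := by
        rw [hA, measure_biUnion_finset D fun c _ => measurableSet_ball]
        simp only [μ.addHaar_ball_of_pos _ hδ]
        simp only [Finset.sum_const, nsmul_eq_mul, mul_assoc]
      _ ≤ μ (ball (0 : E) (1 + ε / 2)) := measure_mono A_subset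
      _ = ENNReal.ofReal ((1 + ε / 2) ^ finrank ℝ E) * μ (ball 0 1) := by
        simp only [μ.addHaar_ball_of_pos _ hρ]
  have J : (s.card : ℝ≥0∞) * ENNReal.ofReal ((ε / 2) ^ finrank ℝ E)
      ≤ ENNReal.ofReal ((1 + ε / 2) ^ finrank ℝ E) :=
    (ENNReal.mul_le_mul_iff_left (measure_ball_pos _ _ zero_lt_one).ne' measure_ball_lt_top.ne).1 I
  have K := ENNReal.toReal_le_of_le_ofReal (by positivity) J
  rw [ENNReal.toReal_mul, ENNReal.toReal_natCast, ENNReal.toReal_ofReal (by positivity),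
    ← le_div_iff₀ (by positivity), ← div_pow] at K
  have e : 1 + 2 / ε = (1 + ε / 2) / (ε / 2) := by field_simp; ring
  rwa [e]

/-- Every subset of the unit ball has an internal `ε`-net with at most `(1 + 2 / ε) ^ dim`
elements. -/
lemma exists_finset_net {ε : ℝ} (hε : 0 < ε) (S : Set E) (hS : ∀ c ∈ S, ‖c‖ ≤ 1) :
    ∃ N : Finset E, (∀ c ∈ N, c ∈ S) ∧ (N.card : ℝ) ≤ (1 + 2 / ε) ^ finrank ℝ E ∧
      ∀ h ∈ S, ∃ c ∈ N, ‖h - c‖ < ε := by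
  classical
  -- The cardinalities of separated subsets of S are bounded, so a largest one exists; by maximality
  -- it is a net, with points inside S.
  let K : Set ℕ := {k | ∃ N : Finset E, (∀ c ∈ N, c ∈ S) ∧
    (∀ c ∈ N, ∀ d ∈ N, c ≠ d → ε ≤ ‖c - d‖) ∧ N.card = k}
  have hbound : ∀ N : Finset E, (∀ c ∈ N, c ∈ S) →
      (∀ c ∈ N, ∀ d ∈ N, c ≠ d → ε ≤ ‖c - d‖) → (N.card : ℝ) ≤ (1 + 2 / ε) ^ finrank ℝ E :=
    fun N hN hsep => card_le_of_separated_unitBall hε N (fun c hc => hS c (hN c hc)) hsep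
  have hbdd : BddAbove K := by
    refine ⟨⌊(1 + 2 / ε) ^ finrank ℝ E⌋₊, ?_⟩
    rintro k ⟨N, hN, hsep, rfl⟩
    exact Nat.le_floor (hbound N hN hsep)
  have hne : K.Nonempty := ⟨0, ∅, by simp, by simp, by simp⟩
  obtain ⟨N, hN, hsep, hcard⟩ := Nat.sSup_mem hne hbdd
  refine ⟨N, hN, hbound N hN hsep, fun h hh => ?_⟩
  by_contra! hcon
  have hnot : h ∉ N := fun hmem => by
    have := hcon h hmem
    simp at this
    linarith
  have hmem : N.card + 1 ∈ K := by
    refine ⟨insert h N, ?_, ?_, Finset.card_insert_of_notMem hnot⟩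
    · intro c hc
      rcases Finset.mem_insert.1 hc with rfl | hc
      exacts [hh, hN c hc]
    · intro c hc d hd hcd
      rcases Finset.mem_insert.1 hc with rfl | hc' <;> rcases Finset.mem_insert.1 hd with rfl | hd'
      · exact absurd rfl hcd
      · exact hcon d hd'
      · rw [norm_sub_rev]; exact hcon c hc'
      · exact hsep c hc' d hd' hcd
  have := le_csSup hbdd hmem
  omega

end Nets

/-! ### Projections and modulus of the complex Gaussian -/

section GaussianLaw

open Complex

instance : IsProbabilityMeasure stdComplexGaussian :=
  Measure.isProbabilityMeasure_map (by fun_prop)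

instance (n : ℕ) : IsProbabilityMeasure (stdComplexGaussianVec n) :=
  Measure.isProbabilityMeasure_map (by fun_prop)

lemma charFun_stdComplexGaussian (t : ℂ) :
    charFun stdComplexGaussian t = exp (-(‖t‖ ^ 2 / 4 : ℝ)) := by
  rw [charFun_apply, stdComplexGaussian, integral_map (by fun_prop) (by fun_prop)]
  have h : ∀ p : ℝ × ℝ, exp ((inner ℝ ((p.1 : ℂ) + (p.2 : ℂ) * I) t : ℝ) * I)
      = exp (t.re * p.1 * I) * exp (t.im * p.2 * I) := by
    intro p
    rw [← Complex.exp_add, Complex.inner]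
    congr 1
    simp
    ring
  simp_rw [h]
  rw [integral_prod_mul (fun x : ℝ => exp (t.re * x * I)) (fun x : ℝ => exp (t.im * x * I)),
    ← charFun_apply_real, ← charFun_apply_real, charFun_gaussianReal, charFun_gaussianReal,
    ← Complex.exp_add]
  congr 1
  rw [← Complex.normSq_eq_norm_sq, Complex.normSq_apply]
  push_cast
  simp
  ring

lemma charFun_stdComplexGaussianVec {n : ℕ} (t : Vec n) :
    charFun (stdComplexGaussianVec n) t = exp (-(‖t‖ ^ 2 / 4 : ℝ)) := by
  rw [stdComplexGaussianVec, charFun_pi]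
  simp_rw [charFun_stdComplexGaussian]
  rw [← Complex.exp_sum, EuclideanSpace.norm_sq_eq, Finset.sum_div]
  push_cast
  rw [Finset.sum_neg_distrib]

lemma inner_real_eq_re_inner {n : ℕ} (v w : Vec n) : inner ℝ v w = (inner ℂ v w).re := by
  simp only [PiLp.inner_apply, Complex.re_sum, Complex.inner]
  exact Finset.sum_congr rfl fun i _ => by simp

/-- Characteristic functions reduce independence to Pythagoras for orthogonal e and h. The vector h
is not normalised, and h = 0 is allowed; that case yields the one-dimensional marginal. -/
lemma map_inner_pair_stdComplexGaussianVec {n : ℕ} {e h : Vec n} (he : ‖e‖ = 1)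
    (heh : inner ℂ e h = 0) :
    (stdComplexGaussianVec n).map (fun a => (inner ℂ a e, inner ℂ a h)) =
      stdComplexGaussian.prod (stdComplexGaussian.map (fun w => (‖h‖ : ℂ) * w)) := by
  have hmeas : Measurable (fun a : Vec n => (inner ℂ a e, inner ℂ a h)) :=
    Continuous.measurable (by fun_prop)
  have : IsProbabilityMeasure ((stdComplexGaussianVec n).map
    (fun a => (inner ℂ a e, inner ℂ a h))) := Measure.isProbabilityMeasure_map hmeas.aemeasurable
  have : IsProbabilityMeasure (stdComplexGaussian.map (fun w => (‖h‖ : ℂ) * w)) :=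
    Measure.isProbabilityMeasure_map (by fun_prop)
  rw [← charFun_eq_prod_iff]
  intro t
  rw [charFun_apply, integral_map (by fun_prop) (by fun_prop), integral_map hmeas.aemeasurable
    (by fun_prop)]
  have h1 : ∀ a : Vec n, inner ℝ (WithLp.toLp 2 (inner ℂ a e, inner ℂ a h)) t
      = inner ℝ a (starRingEnd ℂ t.fst • e + starRingEnd ℂ t.snd • h) := by
    intro a
    rw [inner_real_eq_re_inner, inner_add_right, inner_smul_right, inner_smul_right,
      WithLp.prod_inner_apply, Complex.inner, Complex.inner]
    simp [-inner_conj_symm]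
  simp_rw [h1]
  rw [← charFun_apply, charFun_stdComplexGaussianVec, charFun_stdComplexGaussian]
  have h2 : charFun (stdComplexGaussian.map (fun w => (‖h‖ : ℂ) * w)) t.snd
      = exp (-((‖h‖ * ‖t.snd‖) ^ 2 / 4 : ℝ)) := by
    have := charFun_map_smul (μ := stdComplexGaussian) ‖h‖ t.snd
    simp only [Complex.real_smul] at this
    rw [this, charFun_stdComplexGaussian, norm_mul, Complex.norm_real, norm_norm]
  change _ = exp (-(‖t.fst‖ ^ 2 / 4 : ℝ)) *
    charFun (stdComplexGaussian.map (fun w => (‖h‖ : ℂ) * w)) t.snd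
  rw [h2, ← Complex.exp_add]
  congr 1
  have h3 : ‖starRingEnd ℂ t.fst • e + starRingEnd ℂ t.snd • h‖ ^ 2
      = ‖t.fst‖ ^ 2 + (‖h‖ * ‖t.snd‖) ^ 2 := by
    rw [norm_add_sq (𝕜 := ℂ), inner_smul_left, inner_smul_right, heh, norm_smul, norm_smul, he]
    simp
    ring
  rw [h3]
  push_cast
  ring

lemma map_inner_stdComplexGaussianVec {n : ℕ} {e : Vec n} (he : ‖e‖ = 1) :
    (stdComplexGaussianVec n).map (fun a => inner ℂ a e) = stdComplexGaussian := by
  have h := map_inner_pair_stdComplexGaussianVec (h := 0) he (by simp)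
  have : IsProbabilityMeasure (stdComplexGaussian.map (fun w => ((‖(0 : Vec n)‖ : ℝ) : ℂ) * w)) :=
    Measure.isProbabilityMeasure_map (by fun_prop)
  have h2 := congrArg (Measure.map Prod.fst) h
  rw [Measure.map_map measurable_fst (Continuous.measurable (by fun_prop)),
    Measure.map_fst_prod, measure_univ, one_smul] at h2
  exact h2

open scoped ENNReal

/-- The squared modulus of a standard complex Gaussian is exponentially distributed. -/
lemma lintegral_normSq_stdComplexGaussian {f : ℝ → ℝ≥0∞} (hf : Measurable f) :
    ∫⁻ w, f (‖w‖ ^ 2) ∂stdComplexGaussian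
      = ∫⁻ y in Set.Ioi (0 : ℝ), ENNReal.ofReal (Real.exp (-y)) * f y := by
  have hfw : Measurable fun w : ℂ => f (‖w‖ ^ 2) := hf.comp (by fun_prop)
  have hfp : Measurable fun p : ℝ × ℝ => f (‖(p.1 : ℂ) + (p.2 : ℂ) * I‖ ^ 2) :=
    hf.comp (by fun_prop)
  rw [stdComplexGaussian, lintegral_map hfw (by fun_prop),
    gaussianReal_of_var_ne_zero _ (by norm_num), prod_withDensity (by fun_prop) (by fun_prop),
    lintegral_withDensity_eq_lintegral_mul _ (by fun_prop) hfp,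
    ← Measure.volume_eq_prod, ← lintegral_comp_polarCoord_symm, polarCoord_target,
    Measure.volume_eq_prod, ← Measure.prod_restrict]
  have hint : ∀ p : ℝ × ℝ, ENNReal.ofReal p.1 •
      ((fun z : ℝ × ℝ => gaussianPDF 0 (1 / 2) z.1 * gaussianPDF 0 (1 / 2) z.2) *
        fun p : ℝ × ℝ => f (‖(p.1 : ℂ) + (p.2 : ℂ) * I‖ ^ 2)) (polarCoord.symm p)
      = ENNReal.ofReal (p.1 * (Real.pi⁻¹ * Real.exp (-p.1 ^ 2))) * f (p.1 ^ 2) := by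
    intro p
    have h1 : ‖((p.1 * Real.cos p.2 : ℝ) : ℂ) + ((p.1 * Real.sin p.2 : ℝ) : ℂ) * I‖ ^ 2
        = p.1 ^ 2 := by
      rw [← Complex.normSq_eq_norm_sq, Complex.normSq_add_mul_I]
      linear_combination p.1 ^ 2 * Real.sin_sq_add_cos_sq p.2
    have h2 : gaussianPDF 0 (1 / 2) (p.1 * Real.cos p.2) * gaussianPDF 0 (1 / 2) (p.1 * Real.sin p.2)
        = ENNReal.ofReal (Real.pi⁻¹ * Real.exp (-p.1 ^ 2)) := by
      rw [gaussianPDF, gaussianPDF, ← ENNReal.ofReal_mul (gaussianPDFReal_nonneg _ _ _)]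
      congr 1
      simp only [gaussianPDFReal]
      have hpi : √(2 * Real.pi * ((1 / 2 : NNReal) : ℝ)) = √Real.pi := by
        congr 1; push_cast; ring
      rw [hpi, mul_mul_mul_comm, ← mul_inv, Real.mul_self_sqrt Real.pi_pos.le, ← Real.exp_add]
      congr 2
      push_cast
      linear_combination - p.1 ^ 2 * Real.sin_sq_add_cos_sq p.2
    simp only [polarCoord_symm_apply, Pi.mul_apply, smul_eq_mul]
    rw [h1, h2, ← mul_assoc, mul_comm (ENNReal.ofReal p.1),
      ← ENNReal.ofReal_mul (by positivity), mul_comm p.1]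
  simp_rw [hint]
  rw [lintegral_prod _ (by fun_prop)]
  simp only [lintegral_const, Measure.restrict_apply MeasurableSet.univ, Set.univ_inter,
    Real.volume_Ioo]
  -- In polar coordinates the angle integrates out, leaving the radial density 2r exp(-r²); the
  -- substitution y = r² turns it into exp(-y).
  have himage : (fun r : ℝ => r ^ 2) '' Set.Ioi 0 = Set.Ioi 0 := by
    ext y
    constructor
    · rintro ⟨r, hr, rfl⟩
      exact pow_pos (Set.mem_Ioi.1 hr) 2
    · intro hy
      exact ⟨√y, Real.sqrt_pos.2 hy, Real.sq_sqrt (le_of_lt hy)⟩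
  conv_rhs => rw [← himage]
  rw [lintegral_image_eq_lintegral_abs_deriv_mul measurableSet_Ioi
    (f' := fun r => 2 * r) (fun r _ => by simpa using (hasDerivAt_pow 2 r).hasDerivWithinAt)
    (fun r hr s hs h => by
      exact (sq_eq_sq₀ (le_of_lt hr) (le_of_lt hs)).1 h)]
  refine setLIntegral_congr_fun measurableSet_Ioi fun r hr => ?_
  have hr' : 0 < r := hr
  rw [mul_right_comm, ← ENNReal.ofReal_mul (by positivity), ← mul_assoc (ENNReal.ofReal |2 * r|),
    ← ENNReal.ofReal_mul (by positivity), abs_of_pos (by positivity)]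
  congr 2
  field_simp
  ring

end GaussianLaw

/-! ### Moments and the truncated tail functional -/

section Moments

open scoped ENNReal

lemma lintegral_exp_neg_mul_pow (k : ℕ) :
    ∫⁻ y in Set.Ioi (0 : ℝ), ENNReal.ofReal (Real.exp (-y) * y ^ k)
      = ENNReal.ofReal (k.factorial : ℝ) := by
  have h1 : ∀ y : ℝ, Real.exp (-y) * y ^ k = Real.exp (-y) * y ^ ((k + 1 : ℝ) - 1) := by
    intro y; rw [add_sub_cancel_right, Real.rpow_natCast]
  simp_rw [h1]
  rw [← ofReal_integral_eq_lintegral_ofReal (Real.GammaIntegral_convergent (by positivity)),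
    ← Real.Gamma_eq_integral (by positivity), Real.Gamma_nat_eq_factorial]
  refine (ae_restrict_mem measurableSet_Ioi).mono fun y hy => ?_
  have : 0 < y := hy
  simp only [Pi.zero_apply]
  positivity

/-- Split at x = κs: below it the minimum is at most 1 and contributes κs; above it the integral of
κs/x contributes κs log(1/κ). -/
lemma lintegral_min_div_le {κ s : ℝ} (hκ : 0 < κ) (hκ1 : κ ≤ 1) (hs : 0 < s) :
    ∫⁻ x in Set.Ioo 0 s, ENNReal.ofReal (min (κ * (s / x)) 1)
      ≤ ENNReal.ofReal (κ * (1 + Real.log (1 / κ)) * s) := by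
  have hκs : 0 < κ * s := by positivity
  have hlog : 0 ≤ Real.log (1 / κ) := Real.log_nonneg (by rw [le_div_iff₀ hκ]; linarith)
  have hle : κ * s ≤ s := by nlinarith
  have hsub : Set.Ioo 0 s ⊆ Set.Ioc 0 (κ * s) ∪ Set.Ioc (κ * s) s := by
    rintro x ⟨h0, h1⟩
    rcases le_or_gt x (κ * s) with h | h
    exacts [Or.inl ⟨h0, h⟩, Or.inr ⟨h, h1.le⟩]
  calc ∫⁻ x in Set.Ioo 0 s, ENNReal.ofReal (min (κ * (s / x)) 1)
      ≤ ∫⁻ x in Set.Ioc 0 (κ * s) ∪ Set.Ioc (κ * s) s, ENNReal.ofReal (min (κ * (s / x)) 1) :=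
        lintegral_mono_set hsub
    _ ≤ (∫⁻ x in Set.Ioc 0 (κ * s), ENNReal.ofReal (min (κ * (s / x)) 1))
        + ∫⁻ x in Set.Ioc (κ * s) s, ENNReal.ofReal (min (κ * (s / x)) 1) :=
        lintegral_union_le _ _ _
    _ ≤ (∫⁻ _ in Set.Ioc 0 (κ * s), 1) + ∫⁻ x in Set.Ioc (κ * s) s, ENNReal.ofReal (κ * s * x⁻¹) := by
        refine add_le_add (lintegral_mono fun x => ?_) (lintegral_mono fun x => ?_)
        · exact ENNReal.ofReal_le_one.2 (min_le_right _ _)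
        · refine ENNReal.ofReal_le_ofReal ((min_le_left _ _).trans_eq ?_)
          rw [div_eq_mul_inv, mul_assoc]
    _ = ENNReal.ofReal (κ * s) + ENNReal.ofReal (κ * s * Real.log (1 / κ)) := by
        congr 1
        · simp
        · have hint : IntegrableOn (fun x : ℝ => κ * s * x⁻¹) (Set.Ioc (κ * s) s) := by
            rw [← intervalIntegrable_iff_integrableOn_Ioc_of_le hle]
            refine (intervalIntegral.intervalIntegrable_inv (fun x hx => ?_) ?_).const_mul _
            · rw [Set.uIcc_of_le hle] at hx
              exact (lt_of_lt_of_le hκs hx.1).ne'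
            · fun_prop
          rw [← ofReal_integral_eq_lintegral_ofReal hint, ← intervalIntegral.integral_of_le hle,
            intervalIntegral.integral_const_mul, integral_inv_of_pos hκs hs]
          · congr 3
            field_simp
          · refine (ae_restrict_mem measurableSet_Ioc).mono fun x hx => ?_
            have : 0 < x := lt_trans hκs hx.1
            simp only [Pi.zero_apply]
            positivity
    _ = _ := by
        rw [← ENNReal.ofReal_add hκs.le (by positivity)]
        congr 1
        ring

/-- The tail functional for two independent exponential variables. -/
lemma lintegral_tail_exp_le {κ : ℝ} (hκ : 0 < κ) (hκ1 : κ ≤ 1) :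
    ∫⁻ x in Set.Ioi (0 : ℝ), ENNReal.ofReal (Real.exp (-x)) *
      ∫⁻ y in Set.Ioi (0 : ℝ), ENNReal.ofReal (Real.exp (-y)) *
        ENNReal.ofReal ((x + y) * min (κ * ((x + y) / x)) 1)
      ≤ ENNReal.ofReal (2 * κ * (1 + Real.log (1 / κ))) := by
  have hlog : 0 ≤ Real.log (1 / κ) := Real.log_nonneg (by rw [le_div_iff₀ hκ]; linarith)
  -- Substitute s = x + y and swap the integrals. For fixed s, the integral over x in (0, s) is at
  -- most κ(1 + log(1/κ)) s² exp(-s), and ∫ s² exp(-s) = 2.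
  let G : ℝ → ℝ → ℝ≥0∞ := fun x s =>
    (Set.Ioi x).indicator (fun s => ENNReal.ofReal (Real.exp (-s) * (s * min (κ * (s / x)) 1))) s
  have hGmeas : Measurable (Function.uncurry fun x s => G x s) := by
    have : (Function.uncurry fun x s => G x s) = {p : ℝ × ℝ | p.1 < p.2}.indicator
        (fun p => ENNReal.ofReal (Real.exp (-p.2) * (p.2 * min (κ * (p.2 / p.1)) 1))) := by
      ext ⟨x, s⟩
      simp only [Function.uncurry, G, Set.indicator, Set.mem_Ioi, Set.mem_ofPred_eq]
    rw [this]
    exact Measurable.indicator (by fun_prop) (measurableSet_lt measurable_fst measurable_snd)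
  have h1 : ∀ x ∈ Set.Ioi (0 : ℝ), ENNReal.ofReal (Real.exp (-x)) *
      ∫⁻ y in Set.Ioi (0 : ℝ), ENNReal.ofReal (Real.exp (-y)) *
        ENNReal.ofReal ((x + y) * min (κ * ((x + y) / x)) 1) = ∫⁻ s, G x s := by
    intro x hx
    rw [← lintegral_const_mul _ (by fun_prop), ← lintegral_add_left_eq_self (fun s => G x s) x,
      ← lintegral_indicator measurableSet_Ioi]
    refine lintegral_congr fun y => ?_
    by_cases hy : 0 < y
    · have hxy : x + y ∈ Set.Ioi x := by simpa using hy
      rw [Set.indicator_of_mem (Set.mem_Ioi.2 hy)]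
      simp only [G]
      rw [Set.indicator_of_mem hxy, ← mul_assoc, ← ENNReal.ofReal_mul (by positivity),
        ← Real.exp_add, ← ENNReal.ofReal_mul (by positivity)]
      congr 3
      ring
    · have hxy : x + y ∉ Set.Ioi x := by simpa using hy
      simp only [G]
      rw [Set.indicator_of_notMem (by simpa using hy), Set.indicator_of_notMem hxy]
  rw [setLIntegral_congr_fun measurableSet_Ioi h1, ← lintegral_indicator measurableSet_Ioi]
  have h2 : ∫⁻ x, (Set.Ioi (0 : ℝ)).indicator (fun x => ∫⁻ s, G x s) x
      = ∫⁻ x, ∫⁻ s, (Set.Ioi (0 : ℝ)).indicator (fun x => G x s) x := by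
    refine lintegral_congr fun x => ?_
    by_cases hx : x ∈ Set.Ioi (0 : ℝ)
    · simp only [Set.indicator_of_mem hx]
    · simp only [Set.indicator_of_notMem hx, lintegral_zero]
  rw [h2, lintegral_lintegral_swap]
  swap
  · have : (Function.uncurry fun x s => (Set.Ioi (0 : ℝ)).indicator (fun x => G x s) x)
        = (Set.Ioi (0 : ℝ) ×ˢ Set.univ).indicator (Function.uncurry fun x s => G x s) := by
      ext ⟨x, s⟩
      simp only [Function.uncurry, Set.indicator, Set.mem_prod, Set.mem_univ, and_true]
    rw [this]
    exact (hGmeas.indicator (measurableSet_Ioi.prod MeasurableSet.univ)).aemeasurable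
  have h3 : ∀ s, ∫⁻ x, (Set.Ioi (0 : ℝ)).indicator (fun x => G x s) x
      ≤ (Set.Ioi (0 : ℝ)).indicator (fun s => ENNReal.ofReal
        (κ * (1 + Real.log (1 / κ)) * (Real.exp (-s) * s ^ 2))) s := by
    intro s
    by_cases hs : 0 < s
    · rw [Set.indicator_of_mem (Set.mem_Ioi.2 hs)]
      have h4 : ∀ x, (Set.Ioi (0 : ℝ)).indicator (fun x => G x s) x
          = (Set.Ioo 0 s).indicator (fun x => ENNReal.ofReal (Real.exp (-s) * s)
            * ENNReal.ofReal (min (κ * (s / x)) 1)) x := by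
        intro x
        simp only [G, Set.indicator, Set.mem_Ioi, Set.mem_Ioo]
        rw [← ENNReal.ofReal_mul (by positivity), mul_assoc]
        split_ifs <;> first | rfl | tauto
      simp_rw [h4]
      rw [lintegral_indicator measurableSet_Ioo, lintegral_const_mul _ (by fun_prop)]
      refine (mul_le_mul_right (lintegral_min_div_le hκ hκ1 hs) _).trans_eq ?_
      rw [← ENNReal.ofReal_mul (by positivity)]
      congr 1
      ring
    · have h4 : ∀ x, (Set.Ioi (0 : ℝ)).indicator (fun x => G x s) x = 0 := by
        intro x
        simp only [G, Set.indicator, Set.mem_Ioi]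
        split_ifs with h5 h6
        · exact absurd (h5.trans h6) hs
        · rfl
        · rfl
      simp [h4]
  refine (lintegral_mono h3).trans_eq ?_
  rw [lintegral_indicator measurableSet_Ioi]
  have h5 : ∀ s, ENNReal.ofReal (κ * (1 + Real.log (1 / κ)) * (Real.exp (-s) * s ^ 2))
      = ENNReal.ofReal (κ * (1 + Real.log (1 / κ))) * ENNReal.ofReal (Real.exp (-s) * s ^ 2) :=
    fun s => ENNReal.ofReal_mul (by positivity)
  simp_rw [h5]
  rw [lintegral_const_mul _ (by fun_prop), lintegral_exp_neg_mul_pow,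
    ← ENNReal.ofReal_mul (by positivity)]
  congr 1
  simp
  ring

lemma lintegral_tail_stdComplexGaussian_le {κ : ℝ} (hκ : 0 < κ) (hκ1 : κ ≤ 1) :
    ∫⁻ p : ℂ × ℂ, ENNReal.ofReal ((‖p.1‖ ^ 2 + ‖p.2‖ ^ 2) *
        min (κ * ((‖p.1‖ ^ 2 + ‖p.2‖ ^ 2) / ‖p.1‖ ^ 2)) 1)
        ∂(stdComplexGaussian.prod stdComplexGaussian)
      ≤ ENNReal.ofReal (2 * κ * (1 + Real.log (1 / κ))) := by
  refine le_trans (le_of_eq ?_) (lintegral_tail_exp_le hκ hκ1)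
  rw [lintegral_prod _ (by fun_prop)]
  have h1 : ∀ g : ℂ, ∫⁻ w : ℂ, ENNReal.ofReal ((‖g‖ ^ 2 + ‖w‖ ^ 2) *
        min (κ * ((‖g‖ ^ 2 + ‖w‖ ^ 2) / ‖g‖ ^ 2)) 1) ∂stdComplexGaussian
      = ∫⁻ y in Set.Ioi (0 : ℝ), ENNReal.ofReal (Real.exp (-y)) *
        ENNReal.ofReal ((‖g‖ ^ 2 + y) * min (κ * ((‖g‖ ^ 2 + y) / ‖g‖ ^ 2)) 1) := fun g =>
    lintegral_normSq_stdComplexGaussian (f := fun y => ENNReal.ofReal ((‖g‖ ^ 2 + y) *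
        min (κ * ((‖g‖ ^ 2 + y) / ‖g‖ ^ 2)) 1)) (by fun_prop)
  simp_rw [h1]
  exact lintegral_normSq_stdComplexGaussian (f := fun x => ∫⁻ y in Set.Ioi (0 : ℝ),
    ENNReal.ofReal (Real.exp (-y)) * ENNReal.ofReal ((x + y) * min (κ * ((x + y) / x)) 1))
    (Measurable.lintegral_prod_right (by fun_prop))

lemma lintegral_exp_half_normSq :
    ∫⁻ w, ENNReal.ofReal (Real.exp (‖w‖ ^ 2 / 2)) ∂stdComplexGaussian = 2 := by
  rw [lintegral_normSq_stdComplexGaussian (f := fun y => ENNReal.ofReal (Real.exp (y / 2)))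
    (by fun_prop)]
  have h : ∀ y : ℝ, ENNReal.ofReal (Real.exp (-y)) * ENNReal.ofReal (Real.exp (y / 2))
      = ENNReal.ofReal (Real.exp (-(1 / 2) * y)) := by
    intro y
    rw [← ENNReal.ofReal_mul (Real.exp_pos _).le, ← Real.exp_add]
    congr 2
    ring
  simp_rw [h]
  rw [← ofReal_integral_eq_lintegral_ofReal (exp_neg_integrableOn_Ioi 0 (by norm_num))
    (Filter.Eventually.of_forall fun y => (Real.exp_pos _).le), integral_exp_mul_Ioi (by norm_num)]
  norm_num

lemma integrable_exp_half_normSq :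
    Integrable (fun w : ℂ => Real.exp (‖w‖ ^ 2 / 2)) stdComplexGaussian := by
  refine ⟨by fun_prop, ?_⟩
  rw [hasFiniteIntegral_iff_ofReal (Filter.Eventually.of_forall fun y => (Real.exp_pos _).le),
    lintegral_exp_half_normSq]
  norm_num

lemma integral_exp_half_normSq : ∫ w, Real.exp (‖w‖ ^ 2 / 2) ∂stdComplexGaussian = 2 := by
  rw [integral_eq_lintegral_of_nonneg_ae (Filter.Eventually.of_forall fun y => (Real.exp_pos _).le)
    (by fun_prop), lintegral_exp_half_normSq]
  norm_num

lemma lintegral_normSq_eq_one :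
    ∫⁻ w, ENNReal.ofReal (‖w‖ ^ 2) ∂stdComplexGaussian = 1 := by
  rw [lintegral_normSq_stdComplexGaussian (f := fun y => ENNReal.ofReal y) (by fun_prop)]
  have := lintegral_exp_neg_mul_pow 1
  simp only [pow_one, Nat.factorial_one, Nat.cast_one, ENNReal.ofReal_one] at this
  rw [← this]
  refine lintegral_congr fun y => ?_
  rw [ENNReal.ofReal_mul (Real.exp_pos _).le]

lemma integrable_normSq : Integrable (fun w : ℂ => ‖w‖ ^ 2) stdComplexGaussian := by
  refine ⟨by fun_prop, ?_⟩
  rw [hasFiniteIntegral_iff_ofReal (Filter.Eventually.of_forall fun y => sq_nonneg _),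
    lintegral_normSq_eq_one]
  norm_num

lemma integral_normSq : ∫ w, ‖w‖ ^ 2 ∂stdComplexGaussian = 1 := by
  rw [integral_eq_lintegral_of_nonneg_ae (Filter.Eventually.of_forall fun y => sq_nonneg _)
    (by fun_prop), lintegral_normSq_eq_one]
  norm_num

/-- Rotation invariance of the standard complex Gaussian. -/
lemma map_mul_stdComplexGaussian {v : ℂ} (hv : ‖v‖ = 1) :
    stdComplexGaussian.map (fun w => v * w) = stdComplexGaussian := by
  have : IsProbabilityMeasure (stdComplexGaussian.map (fun w => v * w)) :=
    Measure.isProbabilityMeasure_map (by fun_prop)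
  refine Measure.ext_of_charFun (funext fun t => ?_)
  rw [charFun_apply, integral_map (by fun_prop) (by fun_prop)]
  have h : ∀ w : ℂ, inner ℝ (v * w) t = inner ℝ w (starRingEnd ℂ v * t) := by
    intro w
    rw [Complex.inner, Complex.inner]
    congr 1
    rw [map_mul]
    ring
  simp_rw [h]
  rw [← charFun_apply, charFun_stdComplexGaussian, charFun_stdComplexGaussian, norm_mul,
    RCLike.norm_conj, hv, one_mul]

lemma integral_comp_mul_stdComplexGaussian {v : ℂ} (hv : ‖v‖ = 1) {f : ℂ → ℝ} (hf : Measurable f) :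
    ∫ w, f (v * w) ∂stdComplexGaussian = ∫ w, f w ∂stdComplexGaussian := by
  conv_rhs => rw [← map_mul_stdComplexGaussian hv]
  rw [integral_map (by fun_prop) hf.aestronglyMeasurable]

lemma integrable_re_sq : Integrable (fun w : ℂ => w.re ^ 2) stdComplexGaussian := by
  refine integrable_normSq.mono' (by fun_prop) (Filter.Eventually.of_forall fun w => ?_)
  rw [Real.norm_of_nonneg (sq_nonneg _), ← sq_abs]
  gcongr
  exact Complex.abs_re_le_norm w

/-- Rotation by I exchanges real and imaginary parts up to sign, so each carries half of E|w|² = 1.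
-/
lemma integral_re_mul_sq {v : ℂ} (hv : ‖v‖ = 1) :
    ∫ w, (v * w).re ^ 2 ∂stdComplexGaussian = 1 / 2 := by
  rw [integral_comp_mul_stdComplexGaussian hv (f := fun w => w.re ^ 2) (by fun_prop)]
  have h1 := integral_comp_mul_stdComplexGaussian (v := Complex.I) (by simp)
    (f := fun w => w.re ^ 2) (by fun_prop)
  have h2 : ∫ w : ℂ, (w.re ^ 2 + (Complex.I * w).re ^ 2) ∂stdComplexGaussian = 1 := by
    rw [← integral_normSq]
    refine integral_congr_ae (Filter.Eventually.of_forall fun w => ?_)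
    simp only [← Complex.normSq_eq_norm_sq, Complex.normSq_apply]
    simp
    ring
  have h3 : Integrable (fun w : ℂ => (Complex.I * w).re ^ 2) stdComplexGaussian := by
    refine integrable_normSq.mono' (by fun_prop) (Filter.Eventually.of_forall fun w => ?_)
    rw [Real.norm_of_nonneg (sq_nonneg _), ← sq_abs]
    gcongr
    refine (Complex.abs_re_le_norm _).trans_eq (by simp)
  rw [integral_add integrable_re_sq h3, h1] at h2
  linarith

lemma integral_re_mul (v : ℂ) : ∫ w, (v * w).re ∂stdComplexGaussian = 0 := by
  have h := integral_comp_mul_stdComplexGaussian (v := -1) (by simp)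
    (f := fun w => (v * w).re) (by fun_prop)
  have h2 : ∀ w : ℂ, (v * (-1 * w)).re = -(v * w).re := fun w => by simp
  simp_rw [h2] at h
  rw [integral_neg] at h
  linarith

end Moments

/-! ### Expected curvature along an aligned direction -/

section Expectation

open scoped ENNReal

@[fun_prop]
lemma measurable_unitPhase : Measurable unitPhase := by
  unfold unitPhase
  exact Measurable.ite (measurableSet_singleton 0) measurable_const (by fun_prop)

lemma measurable_curvMinorant (β κ : ℝ) : Measurable (Function.uncurry (curvMinorant β κ)) := by
  have : Function.uncurry (curvMinorant β κ) = fun p : ℂ × ℂ =>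
    ((starRingEnd ℂ (unitPhase p.1) * p.2).re) ^ 2
      - β * (‖p.2‖ ^ 2 * min (κ * (‖p.2‖ ^ 2 / ‖p.1‖ ^ 2)) 1) := rfl
  rw [this]
  fun_prop

lemma conj_unitPhase_mul_self (g : ℂ) : starRingEnd ℂ (unitPhase g) * g = ‖g‖ := by
  unfold unitPhase
  split_ifs with h
  · simp [h]
  · have : (‖g‖ : ℂ) ≠ 0 := by simpa using h
    rw [map_div₀, Complex.conj_ofReal, div_mul_eq_mul_div, Complex.conj_mul']
    field_simp

lemma norm_combination_sq_le {c s : ℝ} (hcs : c ^ 2 + s ^ 2 = 1) (g w : ℂ) :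
    ‖(c : ℂ) * g + (s : ℂ) * w‖ ^ 2 ≤ ‖g‖ ^ 2 + ‖w‖ ^ 2 := by
  have h1 : ‖(c : ℂ) * g + (s : ℂ) * w‖ ≤ |c| * ‖g‖ + |s| * ‖w‖ := by
    refine (norm_add_le _ _).trans_eq ?_
    rw [norm_mul, norm_mul, Complex.norm_real, Complex.norm_real, Real.norm_eq_abs,
      Real.norm_eq_abs]
  have h2 : ‖(c : ℂ) * g + (s : ℂ) * w‖ ^ 2 ≤ (|c| * ‖g‖ + |s| * ‖w‖) ^ 2 := by gcongr
  have hcs' : |c| ^ 2 + |s| ^ 2 = 1 := by rw [sq_abs, sq_abs, hcs]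
  nlinarith [sq_nonneg (|c| * ‖w‖ - |s| * ‖g‖)]

lemma integrable_normSq_add :
    Integrable (fun p : ℂ × ℂ => ‖p.1‖ ^ 2 + ‖p.2‖ ^ 2)
      (stdComplexGaussian.prod stdComplexGaussian) :=
  (integrable_normSq.comp_fst _).add (integrable_normSq.comp_snd _)

/-- With v the conjugate phase of g, the real part is c|g| + s Re(v w). The cross term has mean
zero, and v w has the same law as w for each fixed g. -/
lemma integral_re_phase_sq {c s : ℝ} (hcs : c ^ 2 + s ^ 2 = 1) :
    ∫ p : ℂ × ℂ, ((starRingEnd ℂ (unitPhase p.1) * ((c : ℂ) * p.1 + (s : ℂ) * p.2)).re) ^ 2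
      ∂(stdComplexGaussian.prod stdComplexGaussian) = c ^ 2 + s ^ 2 / 2 := by
  rw [integral_prod]
  · have h1 : ∀ g : ℂ, ∫ w : ℂ, ((starRingEnd ℂ (unitPhase g) * ((c : ℂ) * g + (s : ℂ) * w)).re) ^ 2
        ∂stdComplexGaussian = c ^ 2 * ‖g‖ ^ 2 + s ^ 2 / 2 := by
      intro g
      set v := starRingEnd ℂ (unitPhase g) with hv
      have hv1 : ‖v‖ = 1 := by rw [hv, RCLike.norm_conj, norm_unitPhase]
      have h2 : ∀ w : ℂ, ((v * ((c : ℂ) * g + (s : ℂ) * w)).re) ^ 2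
          = (c * ‖g‖) ^ 2 + 2 * (c * ‖g‖) * s * (v * w).re + s ^ 2 * (v * w).re ^ 2 := by
        intro w
        have : v * ((c : ℂ) * g + (s : ℂ) * w) = ((c * ‖g‖ : ℝ) : ℂ) + (s : ℂ) * (v * w) := by
          have := conj_unitPhase_mul_self g
          rw [← hv] at this
          push_cast
          rw [← this]
          ring
        rw [this, Complex.add_re, Complex.ofReal_re, Complex.re_ofReal_mul]
        ring
      simp_rw [h2]
      have hi2 : Integrable (fun w : ℂ => (v * w).re ^ 2) stdComplexGaussian := by
        refine integrable_normSq.mono' (by fun_prop) (Filter.Eventually.of_forall fun w => ?_)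
        rw [Real.norm_of_nonneg (sq_nonneg _), ← sq_abs]
        gcongr
        refine (Complex.abs_re_le_norm _).trans_eq (by rw [norm_mul, hv1, one_mul])
      have hi1 : Integrable (fun w : ℂ => (v * w).re) stdComplexGaussian := by
        refine (hi2.add (integrable_const (1 : ℝ))).mono' (by fun_prop)
          (Filter.Eventually.of_forall fun w => ?_)
        rw [Real.norm_eq_abs]
        simp only [Pi.add_apply]
        nlinarith [sq_abs (v * w).re, sq_nonneg (|(v * w).re| - 1), abs_nonneg (v * w).re]
      have hi3 : Integrable (fun w : ℂ => (c * ‖g‖) ^ 2 + 2 * (c * ‖g‖) * s * (v * w).re)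
          stdComplexGaussian := (integrable_const _).add (hi1.const_mul _)
      rw [integral_add hi3 (hi2.const_mul _),
        integral_add (integrable_const _) (hi1.const_mul _), integral_const_mul,
        integral_const_mul, integral_re_mul, integral_re_mul_sq hv1]
      simp
      ring
    simp_rw [h1]
    rw [integral_add (integrable_normSq.const_mul _) (integrable_const _), integral_const_mul,
      integral_normSq]
    simp
  · refine integrable_normSq_add.mono' (by fun_prop) (Filter.Eventually.of_forall fun p => ?_)
    rw [Real.norm_of_nonneg (sq_nonneg _)]
    refine le_trans ?_ (norm_combination_sq_le hcs p.1 p.2)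
    rw [← sq_abs]
    gcongr
    refine (Complex.abs_re_le_norm _).trans_eq ?_
    rw [norm_mul, RCLike.norm_conj, norm_unitPhase, one_mul]

/-- The main term c² + s²/2 is at least 1/2. The truncated term increases with the modulus of c g +
s w, whose square is at most |g|² + |w|², so the bound is uniform in (c, s). -/
lemma integral_curvMinorant_combination_ge {β κ c s : ℝ} (hβ : 0 ≤ β) (hκ : 0 < κ) (hκ1 : κ ≤ 1)
    (hcs : c ^ 2 + s ^ 2 = 1) :
    1 / 2 - β * (2 * κ * (1 + Real.log (1 / κ))) ≤
      ∫ p : ℂ × ℂ, curvMinorant β κ p.1 ((c : ℂ) * p.1 + (s : ℂ) * p.2)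
        ∂(stdComplexGaussian.prod stdComplexGaussian) := by
  have hlog : 0 ≤ Real.log (1 / κ) := Real.log_nonneg (by rw [le_div_iff₀ hκ]; linarith)
  set T : ℂ × ℂ → ℝ := fun p => ‖(c : ℂ) * p.1 + (s : ℂ) * p.2‖ ^ 2 *
    min (κ * (‖(c : ℂ) * p.1 + (s : ℂ) * p.2‖ ^ 2 / ‖p.1‖ ^ 2)) 1 with hT
  have hT0 : ∀ p, 0 ≤ T p := fun p => by positivity
  have hTm : Measurable T := by fun_prop
  have hTle : ∀ p, T p ≤ (‖p.1‖ ^ 2 + ‖p.2‖ ^ 2) *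
        min (κ * ((‖p.1‖ ^ 2 + ‖p.2‖ ^ 2) / ‖p.1‖ ^ 2)) 1 := fun p => by
    have := norm_combination_sq_le hcs p.1 p.2
    simp only [hT]
    gcongr
  have hTi : Integrable T (stdComplexGaussian.prod stdComplexGaussian) := by
    refine integrable_normSq_add.mono' hTm.aestronglyMeasurable
      (Filter.Eventually.of_forall fun p => ?_)
    rw [Real.norm_of_nonneg (hT0 p)]
    exact (hTle p).trans (mul_le_of_le_one_right (by positivity) (min_le_right _ _))
  have hTint : ∫ p, T p ∂(stdComplexGaussian.prod stdComplexGaussian)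
      ≤ 2 * κ * (1 + Real.log (1 / κ)) := by
    rw [integral_eq_lintegral_of_nonneg_ae (Filter.Eventually.of_forall hT0)
      hTm.aestronglyMeasurable]
    refine ENNReal.toReal_le_of_le_ofReal (by positivity) ?_
    refine (lintegral_mono fun p => ?_).trans (lintegral_tail_stdComplexGaussian_le hκ hκ1)
    exact ENNReal.ofReal_le_ofReal (hTle p)
  have hP := integral_re_phase_sq hcs
  have hPi : Integrable (fun p : ℂ × ℂ =>
      ((starRingEnd ℂ (unitPhase p.1) * ((c : ℂ) * p.1 + (s : ℂ) * p.2)).re) ^ 2)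
      (stdComplexGaussian.prod stdComplexGaussian) := by
    refine integrable_normSq_add.mono' (by fun_prop) (Filter.Eventually.of_forall fun p => ?_)
    rw [Real.norm_of_nonneg (sq_nonneg _)]
    refine le_trans ?_ (norm_combination_sq_le hcs p.1 p.2)
    rw [← sq_abs]
    gcongr
    refine (Complex.abs_re_le_norm _).trans_eq ?_
    rw [norm_mul, RCLike.norm_conj, norm_unitPhase, one_mul]
  have : ∫ p : ℂ × ℂ, curvMinorant β κ p.1 ((c : ℂ) * p.1 + (s : ℂ) * p.2)
        ∂(stdComplexGaussian.prod stdComplexGaussian)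
      = (c ^ 2 + s ^ 2 / 2) - β * ∫ p, T p ∂(stdComplexGaussian.prod stdComplexGaussian) := by
    rw [← hP, ← integral_const_mul, ← integral_sub hPi (hTi.const_mul β)]
    rfl
  rw [this]
  have := mul_le_mul_of_nonneg_left hTint hβ
  linarith [sq_nonneg c]

/-- The expected curvature minorant along a unit direction aligned with `e`. -/
lemma integral_curvMinorant_ge {n : ℕ} {e h : Vec n} (he : ‖e‖ = 1) (hh : ‖h‖ = 1)
    (him : (inner ℂ e h).im = 0) {β κ : ℝ} (hβ : 0 ≤ β) (hκ : 0 < κ) (hκ1 : κ ≤ 1) :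
    1 / 2 - β * (2 * κ * (1 + Real.log (1 / κ))) ≤
      ∫ a, curvMinorant β κ (inner ℂ a e) (inner ℂ a h) ∂(stdComplexGaussianVec n) := by
  -- Alignment makes the e-component of h a real multiple c of e, so the phase of a^* e reduces that
  -- component to c|a^* e|.
  set c := (inner ℂ e h).re with hc
  have hceq : inner ℂ e h = (c : ℂ) := Complex.ext (by simp [hc]) (by simpa using him)
  set h' := h - (c : ℂ) • e with hh'
  have horth : inner ℂ e h' = 0 := by
    rw [hh', inner_sub_right, inner_smul_right, hceq, inner_self_eq_norm_sq_to_K, he]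
    simp
  have hcs : c ^ 2 + ‖h'‖ ^ 2 = 1 := by
    have e1 : h = (c : ℂ) • e + h' := by rw [hh']; abel
    have e2 : ‖h‖ ^ 2 = c ^ 2 + ‖h'‖ ^ 2 := by
      conv_lhs => rw [e1]
      rw [norm_add_sq (𝕜 := ℂ), inner_smul_left, horth, norm_smul, he]
      simp
    rw [← e2, hh, one_pow]
  have hmeas : Measurable (fun a : Vec n => (inner ℂ a e, inner ℂ a h')) :=
    Continuous.measurable (by fun_prop)
  have hfm : Measurable fun p : ℂ × ℂ => curvMinorant β κ p.1 ((c : ℂ) * p.1 + p.2) :=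
    (measurable_curvMinorant β κ).comp (by fun_prop : Measurable fun p : ℂ × ℂ =>
      (p.1, (c : ℂ) * p.1 + p.2))
  have h1 : ∫ a, curvMinorant β κ (inner ℂ a e) (inner ℂ a h) ∂(stdComplexGaussianVec n)
      = ∫ p, curvMinorant β κ p.1 ((c : ℂ) * p.1 + p.2)
        ∂((stdComplexGaussianVec n).map (fun a => (inner ℂ a e, inner ℂ a h'))) := by
    rw [integral_map hmeas.aemeasurable hfm.aestronglyMeasurable]
    refine integral_congr_ae (Filter.Eventually.of_forall fun a => ?_)
    simp only
    rw [hh', inner_sub_right, inner_smul_right, add_sub_cancel]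
  have h2 : stdComplexGaussian.prod (stdComplexGaussian.map (fun w => (‖h'‖ : ℂ) * w))
      = (stdComplexGaussian.prod stdComplexGaussian).map
        (fun p : ℂ × ℂ => (p.1, (‖h'‖ : ℂ) * p.2)) := by
    have := Measure.map_prod_map stdComplexGaussian stdComplexGaussian
      (f := id) (g := fun w => (‖h'‖ : ℂ) * w) measurable_id (by fun_prop)
    rw [Measure.map_id] at this
    rw [this]
    rfl
  rw [h1, map_inner_pair_stdComplexGaussianVec he horth, h2,
    integral_map (by fun_prop) hfm.aestronglyMeasurable]
  exact integral_curvMinorant_combination_ge hβ hκ hκ1 hcs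

end Expectation

/-! ### Bernstein bounds and union over a net -/

section Concentration

open scoped ENNReal

lemma exp_le_one_add_add_sq_mul_exp (x : ℝ) :
    Real.exp x ≤ 1 + x + x ^ 2 * Real.exp |x| := by
  have h := Complex.norm_exp_sub_sum_le_norm_mul_exp (x : ℂ) 2
  have e : Complex.exp (x : ℂ) - ∑ k ∈ Finset.range 2, (x : ℂ) ^ k / k.factorial
      = ((Real.exp x - (1 + x) : ℝ) : ℂ) := by
    simp [Finset.sum_range_succ]
  rw [e, Complex.norm_real, Complex.norm_real, Real.norm_eq_abs, Real.norm_eq_abs, sq_abs] at h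
  linarith [le_abs_self (Real.exp x - (1 + x))]

variable {n : ℕ}

lemma integrable_exp_half_normSq_inner {h : Vec n} (hh : ‖h‖ = 1) :
    Integrable (fun a : Vec n => Real.exp (‖inner ℂ a h‖ ^ 2 / 2)) (stdComplexGaussianVec n) ∧
      ∫ a, Real.exp (‖inner ℂ a h‖ ^ 2 / 2) ∂(stdComplexGaussianVec n) = 2 := by
  have hm : Measurable fun a : Vec n => inner ℂ a h := Continuous.measurable (by fun_prop)
  have h1 := map_inner_stdComplexGaussianVec hh
  constructor
  · have := integrable_exp_half_normSq
    rw [← h1] at this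
    exact this.comp_measurable hm
  · have := integral_exp_half_normSq
    rw [← h1, integral_map hm.aemeasurable (by fun_prop)] at this
    exact this

lemma integral_normSq_inner {h : Vec n} (hh : ‖h‖ = 1) :
    ∫ a, ‖inner ℂ a h‖ ^ 2 ∂(stdComplexGaussianVec n) = 1 := by
  have hm : Measurable fun a : Vec n => inner ℂ a h := Continuous.measurable (by fun_prop)
  have := integral_normSq
  rw [← map_inner_stdComplexGaussianVec hh, integral_map hm.aemeasurable (by fun_prop)] at this
  exact this

/-- Bernstein-type bound on the Laplace transform of a functional dominated by `L ‖a^* h‖²`. -/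
lemma integral_exp_neg_le {F : Vec n → ℝ} (hF : Measurable F) {h : Vec n} (hh : ‖h‖ = 1) {L : ℝ}
    (hFL : ∀ a, |F a| ≤ L * ‖inner ℂ a h‖ ^ 2) {θ : ℝ} (hθ : 0 ≤ θ) (hθL : θ * L ≤ 1 / 4) {M : ℝ}
    (hM : M ≤ ∫ a, F a ∂(stdComplexGaussianVec n)) :
    Integrable (fun a => Real.exp (-θ * F a)) (stdComplexGaussianVec n) ∧
    ∫ a, Real.exp (-θ * F a) ∂(stdComplexGaussianVec n)
      ≤ Real.exp (-θ * M + 64 * (θ * L) ^ 2) := by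
  obtain ⟨hi, hint⟩ := integrable_exp_half_normSq_inner hh
  have hFi : Integrable F (stdComplexGaussianVec n) := by
    refine (hi.const_mul (2 * |L|)).mono' hF.aestronglyMeasurable
      (Filter.Eventually.of_forall fun a => ?_)
    rw [Real.norm_eq_abs]
    refine (hFL a).trans ?_
    have h1 := Real.add_one_le_exp (‖inner ℂ a h‖ ^ 2 / 2)
    have h2 : L * ‖inner ℂ a h‖ ^ 2 ≤ |L| * ‖inner ℂ a h‖ ^ 2 :=
      mul_le_mul_of_nonneg_right (le_abs_self L) (sq_nonneg _)
    nlinarith [abs_nonneg L]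
  have hpt : ∀ a, Real.exp (-θ * F a)
      ≤ 1 - θ * F a + 32 * (θ * L) ^ 2 * Real.exp (‖inner ℂ a h‖ ^ 2 / 2) := by
    intro a
    set W := ‖inner ℂ a h‖ ^ 2 with hW
    have hW0 : 0 ≤ W := sq_nonneg _
    have h1 := exp_le_one_add_add_sq_mul_exp (-θ * F a)
    have habs : |-θ * F a| ≤ θ * L * W := by
      rw [abs_mul, abs_neg, abs_of_nonneg hθ, mul_assoc]
      exact mul_le_mul_of_nonneg_left (hFL a) hθ
    have h2 : (-θ * F a) ^ 2 ≤ (θ * L) ^ 2 * W ^ 2 := by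
      rw [← sq_abs, ← mul_pow]
      gcongr
    have h3 : Real.exp |-θ * F a| ≤ Real.exp (W / 4) := by
      refine Real.exp_le_exp.2 (habs.trans ?_)
      nlinarith
    -- From exp(t) ≥ t²/2 at t = W/4. The other factor exp(W/4) comes from θL ≤ 1/4; their product
    -- exp(W/2) has mean 2, hence the constant 64.
    have h4 : W ^ 2 ≤ 32 * Real.exp (W / 4) := by
      have := Real.quadratic_le_exp_of_nonneg (by positivity : 0 ≤ W / 4)
      nlinarith
    have h5 : Real.exp (W / 2) = Real.exp (W / 4) * Real.exp (W / 4) := by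
      rw [← Real.exp_add]; congr 1; ring
    have h6 : (-θ * F a) ^ 2 * Real.exp |-θ * F a|
        ≤ ((θ * L) ^ 2 * (32 * Real.exp (W / 4))) * Real.exp (W / 4) := by
      gcongr
      exact h2.trans (by gcongr)
    rw [h5]
    linarith
  have hri : Integrable (fun a => 1 - θ * F a
      + 32 * (θ * L) ^ 2 * Real.exp (‖inner ℂ a h‖ ^ 2 / 2)) (stdComplexGaussianVec n) :=
    ((integrable_const _).sub (hFi.const_mul _)).add (hi.const_mul _)
  have hexpi : Integrable (fun a => Real.exp (-θ * F a)) (stdComplexGaussianVec n) := by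
    refine hri.mono' (by fun_prop) (Filter.Eventually.of_forall fun a => ?_)
    rw [Real.norm_of_nonneg (Real.exp_pos _).le]
    exact hpt a
  refine ⟨hexpi, ?_⟩
  have hs : Integrable (fun a => 1 - θ * F a) (stdComplexGaussianVec n) :=
    (integrable_const _).sub (hFi.const_mul _)
  calc ∫ a, Real.exp (-θ * F a) ∂(stdComplexGaussianVec n)
      ≤ ∫ a, (1 - θ * F a + 32 * (θ * L) ^ 2 * Real.exp (‖inner ℂ a h‖ ^ 2 / 2))
          ∂(stdComplexGaussianVec n) := integral_mono hexpi hri hpt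
    _ = 1 - θ * (∫ a, F a ∂(stdComplexGaussianVec n)) + 32 * (θ * L) ^ 2 * 2 := by
        rw [integral_add hs (hi.const_mul _), integral_sub (integrable_const _) (hFi.const_mul _),
          integral_const_mul, integral_const_mul, hint]
        simp
    _ ≤ (-θ * M + 64 * (θ * L) ^ 2) + 1 := by nlinarith
    _ ≤ _ := Real.add_one_le_exp _

/-- The law of `m` independent standard complex Gaussian vectors. -/
abbrev sampleLaw (n m : ℕ) : Measure (Fin m → Vec n) :=
  Measure.pi fun _ => stdComplexGaussianVec n

/-- Exponential lower-tail bound for sums of a functional dominated by `L ‖a^* h‖²`. -/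
lemma sampleLaw_sum_le {L δ : ℝ} (hL : 0 < L) (hδ : 0 < δ) : ∃ r : ℝ, 0 < r ∧
    ∀ (n m : ℕ) (F : Vec n → ℝ), Measurable F → ∀ h : Vec n, ‖h‖ = 1 →
      (∀ a, |F a| ≤ L * ‖inner ℂ a h‖ ^ 2) → ∀ M : ℝ, M ≤ ∫ a, F a ∂(stdComplexGaussianVec n) →
      sampleLaw n m {a | ∑ j, F (a j) ≤ m * (M - δ)} ≤ ENNReal.ofReal (Real.exp (-r * m)) := by
  -- The first entry ensures θL ≤ 1/4; the second makes the quadratic term at most half of the gain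
  -- θδ, leaving the rate θδ/2.
  set θ := min (1 / (4 * L)) (δ / (128 * L ^ 2)) with hθdef
  have hθ : 0 < θ := by positivity
  refine ⟨θ * δ / 2, by positivity, fun n m F hF h hh hFL M hM => ?_⟩
  have hθL : θ * L ≤ 1 / 4 := by
    calc θ * L ≤ 1 / (4 * L) * L := by gcongr; exact min_le_left _ _
      _ = 1 / 4 := by field_simp
  have hθ2 : 64 * (θ * L) ^ 2 ≤ θ * δ / 2 := by
    have h1 : θ * (128 * L ^ 2) ≤ δ := by
      rw [← le_div_iff₀ (by positivity)]; exact min_le_right _ _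
    nlinarith
  obtain ⟨hexpi, hmgf⟩ := integral_exp_neg_le hF hh hFL hθ.le hθL hM
  have hprod : ∀ a : Fin m → Vec n, Real.exp (-θ * ∑ j, F (a j))
      = ∏ j, Real.exp (-θ * F (a j)) := by
    intro a; rw [Finset.mul_sum, Real.exp_sum]
  have hi : Integrable (fun a : Fin m → Vec n => Real.exp (-θ * ∑ j, F (a j)))
      (sampleLaw n m) := by
    simp_rw [hprod]
    exact Integrable.fintype_prod (f := fun _ a => Real.exp (-θ * F a)) fun _ => hexpi
  have hmain := measure_le_le_exp_mul_mgf (μ := sampleLaw n m) (X := fun a => ∑ j, F (a j))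
    (m * (M - δ)) (by linarith : -θ ≤ 0) hi
  rw [← ofReal_measureReal]
  refine ENNReal.ofReal_le_ofReal (hmain.trans ?_)
  have hmgf_eq : mgf (fun a : Fin m → Vec n => ∑ j, F (a j)) (sampleLaw n m) (-θ)
      = (∫ a, Real.exp (-θ * F a) ∂(stdComplexGaussianVec n)) ^ m := by
    simp only [mgf]
    simp_rw [hprod]
    rw [integral_fintype_prod_eq_pow (fun a : Vec n => Real.exp (-θ * F a)), Fintype.card_fin]
  rw [hmgf_eq]
  calc Real.exp (- -θ * (m * (M - δ))) * (∫ a, Real.exp (-θ * F a) ∂(stdComplexGaussianVec n)) ^ m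
      ≤ Real.exp (- -θ * (m * (M - δ))) * Real.exp (-θ * M + 64 * (θ * L) ^ 2) ^ m := by
        gcongr
    _ = Real.exp (m * (-(θ * δ) + 64 * (θ * L) ^ 2)) := by
        rw [← Real.exp_nat_mul, ← Real.exp_add]
        congr 1
        ring
    _ ≤ _ := by
        refine Real.exp_le_exp.2 ?_
        have : (0 : ℝ) ≤ m := Nat.cast_nonneg m
        nlinarith

/-- Uniform version of the lower-tail bound over a net of a set of unit vectors. -/
lemma exists_net_sampleLaw_le {L δ ε : ℝ} (hL : 0 < L) (hδ : 0 < δ) (hε : 0 < ε) :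
    ∃ C r : ℝ, 0 < C ∧ 0 < r ∧ ∀ (n m : ℕ), C * (n : ℝ) ≤ m → ∀ (S : Set (Vec n)),
      (∀ h ∈ S, ‖h‖ = 1) → ∀ F : Vec n → Vec n → ℝ, (∀ h ∈ S, Measurable (F h)) →
      (∀ h ∈ S, ∀ a, |F h a| ≤ L * ‖inner ℂ a h‖ ^ 2) → ∀ M : ℝ,
      (∀ h ∈ S, M ≤ ∫ a, F h a ∂(stdComplexGaussianVec n)) →
      ∃ N : Finset (Vec n), (∀ c ∈ N, c ∈ S) ∧ (∀ h ∈ S, ∃ c ∈ N, ‖h - c‖ < ε) ∧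
        sampleLaw n m {a | ∃ c ∈ N, ∑ j, F c (a j) ≤ m * (M - δ)}
          ≤ ENNReal.ofReal (Real.exp (-r * m)) := by
  obtain ⟨r, hr, hbound⟩ := sampleLaw_sum_le hL hδ
  have hlog : 0 < Real.log (1 + 2 / ε) := Real.log_pos (by linarith [div_pos two_pos hε])
  -- The real dimension is 2n, so the net has at most exp(2n log(1+2/ε)) points. This is at most
  -- exp(rm/2) for such m, which costs half of the rate.
  refine ⟨4 * Real.log (1 + 2 / ε) / r, r / 2, by positivity, by positivity, ?_⟩
  intro n m hnm S hS F hF hFL M hM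
  obtain ⟨N, hNS, hcard, hnet⟩ := exists_finset_net hε S (fun c hc => (hS c hc).le)
  refine ⟨N, hNS, hnet, ?_⟩
  have hfin : Module.finrank ℝ (Vec n) = 2 * n := by
    have := finrank_real_of_complex (Vec n)
    rwa [finrank_euclideanSpace_fin] at this
  have hset : {a : Fin m → Vec n | ∃ c ∈ N, ∑ j, F c (a j) ≤ m * (M - δ)}
      = ⋃ c ∈ N, {a : Fin m → Vec n | ∑ j, F c (a j) ≤ m * (M - δ)} := by
    ext a; simp
  rw [hset]
  calc sampleLaw n m (⋃ c ∈ N, {a : Fin m → Vec n | ∑ j, F c (a j) ≤ m * (M - δ)})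
      ≤ ∑ c ∈ N, sampleLaw n m {a : Fin m → Vec n | ∑ j, F c (a j) ≤ m * (M - δ)} :=
        measure_biUnion_finset_le _ _
    _ ≤ ∑ _c ∈ N, ENNReal.ofReal (Real.exp (-r * m)) := Finset.sum_le_sum fun c hc =>
        hbound n m (F c) (hF c (hNS c hc)) c (hS c (hNS c hc)) (hFL c (hNS c hc)) M
          (hM c (hNS c hc))
    _ = ENNReal.ofReal (N.card * Real.exp (-r * m)) := by
        rw [Finset.sum_const, nsmul_eq_mul, ENNReal.ofReal_mul (Nat.cast_nonneg _),
          ENNReal.ofReal_natCast]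
    _ ≤ _ := by
        refine ENNReal.ofReal_le_ofReal ?_
        have h1 : (N.card : ℝ) ≤ Real.exp (r / 2 * m) := by
          refine hcard.trans ?_
          rw [hfin, ← Real.exp_log (by positivity : 0 < 1 + 2 / ε), ← Real.exp_nat_mul]
          refine Real.exp_le_exp.2 ?_
          rw [div_mul_eq_mul_div, div_le_iff₀ hr] at hnm
          push_cast
          linarith
        calc (N.card : ℝ) * Real.exp (-r * m) ≤ Real.exp (r / 2 * m) * Real.exp (-r * m) := by
              gcongr
          _ = _ := by rw [← Real.exp_add]; congr 1; ring

end Concentration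

/-! ### From a net to all directions -/

section Uniform

open scoped ENNReal

/-- The map t ↦ t·min(kt, 1) has slope 2kt ≤ 2 up to t = 1/k and slope 1 beyond, so its Lipschitz
constant does not depend on k. With k = κ/|g|² this gives uniformity in g. -/
lemma mul_min_sub_le {k s t : ℝ} (hk : 0 ≤ k) (hs : 0 ≤ s) (hst : s ≤ t) :
    |t * min (k * t) 1 - s * min (k * s) 1| ≤ 2 * (t - s) := by
  have ht : 0 ≤ t := hs.trans hst
  have hmono : min (k * s) 1 ≤ min (k * t) 1 := by gcongr
  have h0 : 0 ≤ min (k * s) 1 := by positivity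
  have h1 : min (k * t) 1 ≤ 1 := min_le_right _ _
  have h3 : s * min (k * t) 1 ≤ t * min (k * s) 1 := by
    rcases le_total (k * s) 1 with h | h
    · rw [min_eq_left h]
      calc s * min (k * t) 1 ≤ s * (k * t) := by gcongr; exact min_le_left _ _
        _ = _ := by ring
    · rw [min_eq_right h, min_eq_right (h.trans (by gcongr))]
      linarith
  rw [abs_of_nonneg (sub_nonneg.2 (mul_le_mul hst hmono h0 ht))]
  rcases hs.eq_or_lt with rfl | hs'
  · nlinarith
  have h4 : 0 < t := lt_of_lt_of_le hs' hst
  have h5 : s * (min (k * t) 1 - min (k * s) 1) ≤ t - s := by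
    have h6 : t * (s * (min (k * t) 1 - min (k * s) 1)) ≤ t * (t - s) := by
      have h7 : s * (s * min (k * t) 1) ≤ s * (t * min (k * s) 1) := by gcongr
      have h8 : 0 ≤ min (k * t) 1 := by positivity
      have h9 : s * ((t - s) * min (k * t) 1) ≤ t * ((t - s) * 1) := by
        have : 0 ≤ t - s := sub_nonneg.2 hst
        gcongr
      nlinarith
    exact le_of_mul_le_mul_left h6 h4
  nlinarith

/-- The curvature minorant is locally Lipschitz in its second argument, uniformly in the first. -/
lemma abs_curvMinorant_sub_le {β κ : ℝ} (hβ : 0 ≤ β) (hκ : 0 ≤ κ) (g w w' : ℂ) :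
    |curvMinorant β κ g w - curvMinorant β κ g w'|
      ≤ (1 + 2 * β) * ((‖w‖ + ‖w'‖) * ‖w - w'‖) := by
  set v := starRingEnd ℂ (unitPhase g)
  have hv : ‖v‖ = 1 := by rw [RCLike.norm_conj, norm_unitPhase]
  have h1 : |(v * w).re ^ 2 - (v * w').re ^ 2| ≤ (‖w‖ + ‖w'‖) * ‖w - w'‖ := by
    have e : (v * w).re ^ 2 - (v * w').re ^ 2 = (v * (w + w')).re * (v * (w - w')).re := by
      rw [mul_add, mul_sub, Complex.add_re, Complex.sub_re]; ring
    rw [e, abs_mul]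
    gcongr
    · refine (Complex.abs_re_le_norm _).trans ?_
      rw [norm_mul, hv, one_mul]
      exact norm_add_le _ _
    · refine (Complex.abs_re_le_norm _).trans_eq ?_
      rw [norm_mul, hv, one_mul]
  have hsq : |‖w‖ ^ 2 - ‖w'‖ ^ 2| ≤ (‖w‖ + ‖w'‖) * ‖w - w'‖ := by
    rw [sq_sub_sq, abs_mul, abs_of_nonneg (by positivity : 0 ≤ ‖w‖ + ‖w'‖)]
    gcongr
    exact abs_norm_sub_norm_le w w'
  have h2 : |‖w‖ ^ 2 * min (κ / ‖g‖ ^ 2 * ‖w‖ ^ 2) 1 - ‖w'‖ ^ 2 * min (κ / ‖g‖ ^ 2 * ‖w'‖ ^ 2) 1|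
      ≤ 2 * ((‖w‖ + ‖w'‖) * ‖w - w'‖) := by
    refine le_trans ?_ (mul_le_mul_of_nonneg_left hsq two_pos.le)
    rcases le_total (‖w'‖ ^ 2) (‖w‖ ^ 2) with h | h
    · rw [abs_of_nonneg (sub_nonneg.2 h)]
      exact mul_min_sub_le (by positivity) (sq_nonneg _) h
    · rw [abs_sub_comm, abs_sub_comm (‖w‖ ^ 2) (‖w'‖ ^ 2), abs_of_nonneg (sub_nonneg.2 h)]
      exact mul_min_sub_le (by positivity) (sq_nonneg _) h
  have e : curvMinorant β κ g w - curvMinorant β κ g w'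
      = ((v * w).re ^ 2 - (v * w').re ^ 2)
        - β * (‖w‖ ^ 2 * min (κ / ‖g‖ ^ 2 * ‖w‖ ^ 2) 1
          - ‖w'‖ ^ 2 * min (κ / ‖g‖ ^ 2 * ‖w'‖ ^ 2) 1) := by
    simp only [curvMinorant, v]
    rw [mul_div_assoc', mul_div_assoc', div_mul_eq_mul_div, div_mul_eq_mul_div]
    ring
  rw [e]
  refine (abs_sub _ _).trans ?_
  rw [abs_mul, abs_of_nonneg hβ]
  have := mul_le_mul_of_nonneg_left h2 hβ
  linarith

lemma abs_curvMinorant_le {β κ : ℝ} (hβ : 0 ≤ β) (hκ : 0 ≤ κ) (g w : ℂ) :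
    |curvMinorant β κ g w| ≤ (1 + 2 * β) * ‖w‖ ^ 2 := by
  have h := abs_curvMinorant_sub_le hβ hκ g w 0
  have h0 : curvMinorant β κ g 0 = 0 := by simp [curvMinorant]
  rw [h0, sub_zero, sub_zero, norm_zero, add_zero] at h
  rwa [sq]

variable {n m : ℕ}

/-- A self-bounding argument for the supremum B of the quadratic form on the sphere: splitting w = c
+ (w - c) with weights 1+ε and 1+1/ε gives B ≤ (1+ε)²m + (1+ε)εB, which is then solved for B. -/
lemma frame_upper_of_net {a : Fin m → Vec n} {δ : ℝ} (hδ : 0 < δ) (hδ1 : δ ≤ 1)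
    (N : Finset (Vec n)) (hnet : ∀ h : Vec n, ‖h‖ = 1 → ∃ c ∈ N, ‖h - c‖ < δ / 10)
    (hN : ∀ c ∈ N, ∑ j, ‖inner ℂ (a j) c‖ ^ 2 ≤ m * (1 + δ / 10)) (h : Vec n) :
    ∑ j, ‖inner ℂ (a j) h‖ ^ 2 ≤ m * ((1 + δ) * ‖h‖ ^ 2) := by
  set Q : Vec n → ℝ := fun h => ∑ j, ‖inner ℂ (a j) h‖ ^ 2 with hQ
  have hQ0 : ∀ h, 0 ≤ Q h := fun h => by positivity
  have hscale : ∀ {B : ℝ}, (∀ v : Vec n, ‖v‖ = 1 → Q v ≤ B) → ∀ v, Q v ≤ B * ‖v‖ ^ 2 := by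
    intro B hB v
    rcases eq_or_ne v 0 with rfl | hv
    · simp [hQ]
    have hv' : 0 < ‖v‖ := norm_pos_iff.2 hv
    have h1 := hB ((‖v‖⁻¹ : ℂ) • v) (by
      rw [norm_smul, norm_inv, Complex.norm_real, norm_norm, inv_mul_cancel₀ hv'.ne'])
    have h2 : Q ((‖v‖⁻¹ : ℂ) • v) = Q v / ‖v‖ ^ 2 := by
      simp only [hQ, Finset.sum_div, inner_smul_right, norm_mul, norm_inv, Complex.norm_real,
        norm_norm]
      refine Finset.sum_congr rfl fun j _ => ?_
      field_simp
    rwa [h2, div_le_iff₀ (by positivity)] at h1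
  suffices hsuff : ∀ v : Vec n, ‖v‖ = 1 → Q v ≤ m * (1 + δ) by
    have := hscale hsuff h
    rwa [mul_assoc] at this
  intro v hv
  have hm0 : (0 : ℝ) ≤ m := Nat.cast_nonneg m
  set A : Set ℝ := Q '' {w : Vec n | ‖w‖ = 1} with hA
  have hbdd : BddAbove A := by
    refine ⟨∑ j, ‖a j‖ ^ 2, ?_⟩
    rintro _ ⟨w, hw, rfl⟩
    refine Finset.sum_le_sum fun j _ => ?_
    gcongr
    have := norm_inner_le_norm (𝕜 := ℂ) (a j) w
    rwa [show ‖w‖ = 1 from hw, mul_one] at this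
  have hne : A.Nonempty := ⟨Q v, v, hv, rfl⟩
  set B := sSup A
  have hB : ∀ w : Vec n, ‖w‖ = 1 → Q w ≤ B := fun w hw => le_csSup hbdd ⟨w, hw, rfl⟩
  have hB0 : 0 ≤ B := (hQ0 v).trans (hB v hv)
  set ε := δ / 10 with hε
  have hε0 : 0 < ε := by positivity
  have hstep : B ≤ (1 + ε) * (m * (1 + ε)) + (1 + ε) * ε * B := by
    refine csSup_le hne ?_
    rintro _ ⟨w, hw, rfl⟩
    obtain ⟨c, hc, hwc⟩ := hnet w hw
    have h1 : Q w ≤ (1 + ε) * Q c + (1 + 1 / ε) * Q (w - c) := by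
      simp only [hQ, Finset.mul_sum, ← Finset.sum_add_distrib]
      refine Finset.sum_le_sum fun j _ => ?_
      have e1 : inner ℂ (a j) w = inner ℂ (a j) c + inner ℂ (a j) (w - c) := by
        rw [← inner_add_right, add_sub_cancel]
      have h2 : ‖inner ℂ (a j) w‖ ≤ ‖inner ℂ (a j) c‖ + ‖inner ℂ (a j) (w - c)‖ := by
        rw [e1]; exact norm_add_le _ _
      generalize ‖inner ℂ (a j) c‖ = p at *
      generalize ‖inner ℂ (a j) (w - c)‖ = q at *
      calc ‖inner ℂ (a j) w‖ ^ 2 ≤ (p + q) ^ 2 := by gcongr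
        _ ≤ (1 + ε) * p ^ 2 + (1 + 1 / ε) * q ^ 2 := by
          have h3 : 0 ≤ (ε * p - q) ^ 2 / ε := by positivity
          have h4 : (ε * p - q) ^ 2 / ε = ε * p ^ 2 - 2 * p * q + 1 / ε * q ^ 2 := by
            field_simp; ring
          nlinarith
    have h2 : Q (w - c) ≤ B * ε ^ 2 := by
      refine (hscale hB (w - c)).trans ?_
      gcongr
    have h3 : (1 + 1 / ε) * Q (w - c) ≤ (1 + 1 / ε) * (B * ε ^ 2) := by gcongr
    have h4 : (1 + 1 / ε) * (B * ε ^ 2) = (1 + ε) * ε * B := by field_simp; ring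
    have h5 : (1 + ε) * Q c ≤ (1 + ε) * (m * (1 + ε)) := by
      gcongr
      exact hN c hc
    linarith
  refine (hB v hv).trans ?_
  have hpos : 0 < 1 - (1 + ε) * ε := by nlinarith
  have h6 : (1 - (1 + ε) * ε) * B ≤ (1 - (1 + ε) * ε) * (m * (1 + δ)) := by
    have h7 : (1 + ε) * (1 + ε) ≤ (1 - (1 + ε) * ε) * (1 + δ) := by
      have hδε : δ = 10 * ε := by rw [hε]; ring
      rw [hδε]
      have : ε ≤ 1 / 10 := by linarith
      nlinarith [mul_nonneg hε0.le hε0.le, mul_nonneg hε0.le (sub_nonneg.2 this)]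
    nlinarith [mul_le_mul_of_nonneg_left h7 hm0]
  exact le_of_mul_le_mul_left h6 hpos

/-- AM–GM splits the Lipschitz error into ε(|w|² + |w'|²) + |w - w'|²/(2ε). With frame bound 2, the
sum is at most 5(1+2β)εm, which equals mδ/2 for the chosen ε. -/
lemma curvMinorant_sum_of_net {a : Fin m → Vec n} {e : Vec n} {β κ δ M : ℝ} (hβ : 0 ≤ β)
    (hκ : 0 ≤ κ) (hδ : 0 < δ) (S : Set (Vec n)) (hS : ∀ h ∈ S, ‖h‖ = 1) (N : Finset (Vec n))
    (hNS : ∀ c ∈ N, c ∈ S)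
    (hnet : ∀ h ∈ S, ∃ c ∈ N, ‖h - c‖ < δ / (10 * (1 + 2 * β)))
    (hup : ∀ h : Vec n, ∑ j, ‖inner ℂ (a j) h‖ ^ 2 ≤ m * (2 * ‖h‖ ^ 2))
    (hN : ∀ c ∈ N, m * (M - δ / 2) ≤ ∑ j, curvMinorant β κ (inner ℂ (a j) e) (inner ℂ (a j) c))
    {h : Vec n} (hh : h ∈ S) :
    m * (M - δ) ≤ ∑ j, curvMinorant β κ (inner ℂ (a j) e) (inner ℂ (a j) h) := by
  obtain ⟨c, hc, hhc⟩ := hnet h hh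
  have hm0 : (0 : ℝ) ≤ m := Nat.cast_nonneg m
  set L := 1 + 2 * β with hL
  have hL0 : 0 < L := by positivity
  set ε := δ / (10 * L) with hε
  have hε0 : 0 < ε := by positivity
  have h1 : ∀ j, curvMinorant β κ (inner ℂ (a j) e) (inner ℂ (a j) c) ≤
      curvMinorant β κ (inner ℂ (a j) e) (inner ℂ (a j) h)
        + L * (ε * (‖inner ℂ (a j) h‖ ^ 2 + ‖inner ℂ (a j) c‖ ^ 2)
          + 1 / (2 * ε) * ‖inner ℂ (a j) (h - c)‖ ^ 2) := by
    intro j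
    have h2 := abs_curvMinorant_sub_le hβ hκ (inner ℂ (a j) e) (inner ℂ (a j) h) (inner ℂ (a j) c)
    rw [← inner_sub_right] at h2
    have h3 := (abs_le.1 h2).1
    have h4 : (‖inner ℂ (a j) h‖ + ‖inner ℂ (a j) c‖) * ‖inner ℂ (a j) (h - c)‖
        ≤ ε * (‖inner ℂ (a j) h‖ ^ 2 + ‖inner ℂ (a j) c‖ ^ 2)
          + 1 / (2 * ε) * ‖inner ℂ (a j) (h - c)‖ ^ 2 := by
      generalize ‖inner ℂ (a j) h‖ = p
      generalize ‖inner ℂ (a j) c‖ = q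
      generalize ‖inner ℂ (a j) (h - c)‖ = t
      have h5 : 0 ≤ (ε * (p + q) - t) ^ 2 / (2 * ε) := by positivity
      have h6 : (ε * (p + q) - t) ^ 2 / (2 * ε)
          = ε / 2 * (p + q) ^ 2 - (p + q) * t + 1 / (2 * ε) * t ^ 2 := by field_simp; ring
      nlinarith [mul_nonneg hε0.le (sq_nonneg (p - q))]
    have h5 := mul_le_mul_of_nonneg_left h4 hL0.le
    linarith
  have h2 := (hN c hc).trans (Finset.sum_le_sum fun j _ => h1 j)
  simp only [Finset.sum_add_distrib, ← Finset.mul_sum] at h2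
  have h3 := hup h
  have h4 := hup c
  have h5 := hup (h - c)
  rw [hS h hh] at h3
  rw [hS c (hNS c hc)] at h4
  have h6 : ∑ j, ‖inner ℂ (a j) (h - c)‖ ^ 2 ≤ m * (2 * ε ^ 2) := h5.trans (by gcongr)
  have h7 : L * (ε * (∑ j, ‖inner ℂ (a j) h‖ ^ 2 + ∑ j, ‖inner ℂ (a j) c‖ ^ 2)
        + 1 / (2 * ε) * ∑ j, ‖inner ℂ (a j) (h - c)‖ ^ 2)
      ≤ L * (ε * (m * (2 * 1 ^ 2) + m * (2 * 1 ^ 2)) + 1 / (2 * ε) * (m * (2 * ε ^ 2))) := by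
    gcongr
  have h8 : L * (ε * (m * (2 * 1 ^ 2) + m * (2 * 1 ^ 2)) + 1 / (2 * ε) * (m * (2 * ε ^ 2)))
      = m * (δ / 2) := by
    rw [hε]; field_simp; ring
  linarith

/-- With overwhelming probability the samples are regular. -/
theorem sampleLaw_not_isRegular_le {β κ δ : ℝ} (hβ : 0 ≤ β) (hκ : 0 < κ) (hκ1 : κ ≤ 1)
    (hδ : 0 < δ) (hδ1 : δ ≤ 1) :
    ∃ C r : ℝ, 0 < C ∧ 0 < r ∧ ∀ n m : ℕ, C * (n : ℝ) ≤ m → ∀ e : Vec n, ‖e‖ = 1 →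
      sampleLaw n m {a | ¬ IsRegular a e (1 + δ)
          (1 / 2 - β * (2 * κ * (1 + Real.log (1 / κ))) - δ) β κ}
        ≤ ENNReal.ofReal (2 * Real.exp (-r * m)) := by
  have hL : 0 < 1 + 2 * β := by positivity
  obtain ⟨C₁, r₁, hC₁, hr₁, h₁⟩ := exists_net_sampleLaw_le (L := 1) (δ := δ / 10) (ε := δ / 10)
    one_pos (by positivity) (by positivity)
  obtain ⟨C₂, r₂, hC₂, hr₂, h₂⟩ := exists_net_sampleLaw_le (L := 1 + 2 * β) (δ := δ / 2)
    (ε := δ / (10 * (1 + 2 * β))) hL (by positivity) (by positivity)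
  refine ⟨max C₁ C₂, min r₁ r₂, by positivity, by positivity, fun n m hnm e he => ?_⟩
  have hn0 : (0 : ℝ) ≤ n := Nat.cast_nonneg n
  have hm0 : (0 : ℝ) ≤ m := Nat.cast_nonneg m
  set M := 1 / 2 - β * (2 * κ * (1 + Real.log (1 / κ)))
  -- Applying the lower-tail bound to -|a^* h|², of mean -1, gives the upper tail needed for the
  -- frame bound.
  obtain ⟨N₁, hN₁, hnet₁, hp₁⟩ := h₁ n m
    ((mul_le_mul_of_nonneg_right (le_max_left C₁ C₂) hn0).trans hnm) {h | ‖h‖ = 1}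
    (fun h hh => hh) (fun h a => -‖inner ℂ a h‖ ^ 2)
    (fun h _ => Continuous.measurable (by fun_prop))
    (fun h _ a => by rw [abs_neg, abs_of_nonneg (sq_nonneg _), one_mul]) (-1)
    (fun h hh => by rw [integral_neg, integral_normSq_inner hh])
  have hmeas₂ : ∀ h : Vec n, Measurable fun a : Vec n =>
      curvMinorant β κ (inner ℂ a e) (inner ℂ a h) := by
    intro h
    have hpair : Measurable fun a : Vec n => ((inner ℂ a e, inner ℂ a h) : ℂ × ℂ) :=
      Continuous.measurable (by fun_prop)
    have hcomp := (measurable_curvMinorant β κ).comp hpair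
    simpa only [Function.comp_def, Function.uncurry_apply_pair] using hcomp
  have hbound₂ : ∀ h a : Vec n, |curvMinorant β κ (inner ℂ a e) (inner ℂ a h)|
      ≤ (1 + 2 * β) * ‖inner ℂ a h‖ ^ 2 := fun h a => abs_curvMinorant_le hβ hκ.le _ _
  have hM₂ : ∀ h ∈ {h : Vec n | ‖h‖ = 1 ∧ (inner ℂ e h).im = 0},
      M ≤ ∫ a, curvMinorant β κ (inner ℂ a e) (inner ℂ a h) ∂(stdComplexGaussianVec n) :=
    fun h hh => integral_curvMinorant_ge he hh.1 hh.2 hβ hκ hκ1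
  obtain ⟨N₂, hN₂, hnet₂, hp₂⟩ := h₂ n m
    ((mul_le_mul_of_nonneg_right (le_max_right C₁ C₂) hn0).trans hnm)
    {h | ‖h‖ = 1 ∧ (inner ℂ e h).im = 0} (fun h hh => hh.1)
    (fun h a => curvMinorant β κ (inner ℂ a e) (inner ℂ a h))
    (fun h _ => hmeas₂ h) (fun h _ => hbound₂ h) M hM₂
  have hsub : {a : Fin m → Vec n | ¬ IsRegular a e (1 + δ) (M - δ) β κ} ⊆
      {a | ∃ c ∈ N₁, ∑ j, -‖inner ℂ (a j) c‖ ^ 2 ≤ m * (-1 - δ / 10)} ∪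
      {a | ∃ c ∈ N₂, ∑ j, curvMinorant β κ (inner ℂ (a j) e) (inner ℂ (a j) c)
        ≤ m * (M - δ / 2)} := by
    intro a ha
    by_contra hcon
    rw [Set.mem_union, not_or] at hcon
    obtain ⟨hc1, hc2⟩ := hcon
    simp only [Set.mem_ofPred_eq, not_exists, not_and, not_le] at hc1 hc2
    refine ha ?_
    have hup : ∀ h, ∑ j, ‖inner ℂ (a j) h‖ ^ 2 ≤ m * ((1 + δ) * ‖h‖ ^ 2) := by
      refine frame_upper_of_net hδ hδ1 N₁ hnet₁ fun c hc => ?_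
      have := hc1 c hc
      rw [Finset.sum_neg_distrib] at this
      linarith
    refine ⟨hup, fun h hh him => ?_⟩
    refine curvMinorant_sum_of_net hβ hκ.le hδ {h | ‖h‖ = 1 ∧ (inner ℂ e h).im = 0}
      (fun h hh => hh.1) N₂ hN₂ hnet₂ (fun h => (hup h).trans ?_) (fun c hc => (hc2 c hc).le)
      ⟨hh, him⟩
    gcongr
    linarith
  refine (measure_mono hsub).trans ((measure_union_le _ _).trans ((add_le_add hp₁ hp₂).trans ?_))
  rw [← ENNReal.ofReal_add (Real.exp_pos _).le (Real.exp_pos _).le]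
  refine ENNReal.ofReal_le_ofReal ?_
  have e1 : Real.exp (-r₁ * m) ≤ Real.exp (-min r₁ r₂ * m) := by
    refine Real.exp_le_exp.2 ?_
    have := mul_le_mul_of_nonneg_right (min_le_left r₁ r₂) hm0
    linarith
  have e2 : Real.exp (-r₂ * m) ≤ Real.exp (-min r₁ r₂ * m) := by
    refine Real.exp_le_exp.2 ?_
    have := mul_le_mul_of_nonneg_right (min_le_right r₁ r₂) hm0
    linarith
  linarith

end Uniform

/-! ### Numerical constants and the explicit admissible range -/

section Constants

lemma log_six_le : Real.log 6 ≤ 9 / 5 := by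
  have h1 : Real.log ((6 : ℝ) ^ 5) ≤ 9 := by
    rw [Real.log_le_iff_le_exp (by norm_num)]
    have h2 : Real.exp 9 = Real.exp 1 ^ 9 := by rw [← Real.exp_nat_mul]; norm_num
    rw [h2]
    calc (6 : ℝ) ^ 5 ≤ 2.7182818283 ^ 9 := by norm_num
      _ ≤ _ := by gcongr; exact Real.exp_one_gt_d9.le
  rw [Real.log_pow] at h1
  push_cast at h1
  linarith

/-- The logarithm is replaced by its tangent at ρ = 1/6, close to the largest admissible radius, so
that what remains is polynomial in ρ. -/
lemma tail_constant_le {ρ : ℝ} (hρ : 0 < ρ) :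
    2 * ρ ^ 2 * (1 + Real.log (1 / ρ ^ 2)) ≤ 2 / 3 * ρ + 26 / 5 * ρ ^ 2 := by
  have h1 : Real.log (1 / ρ ^ 2) = 2 * (Real.log (1 / (6 * ρ)) + Real.log 6) := by
    rw [← Real.log_mul (by positivity) (by norm_num), one_div, Real.log_inv, Real.log_pow,
      show 1 / (6 * ρ) * 6 = ρ⁻¹ by field_simp, Real.log_inv]
    push_cast
    ring
  have h2 := Real.log_le_sub_one_of_pos (by positivity : 0 < 1 / (6 * ρ))
  have h3 := log_six_le
  have h4 : Real.log (1 / ρ ^ 2) ≤ 1 / (3 * ρ) + 8 / 5 := by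
    have e : 1 / (3 * ρ) = 2 * (1 / (6 * ρ)) := by field_simp; norm_num
    rw [h1, e]
    linarith
  calc 2 * ρ ^ 2 * (1 + Real.log (1 / ρ ^ 2)) ≤ 2 * ρ ^ 2 * (1 + (1 / (3 * ρ) + 8 / 5)) := by gcongr
    _ = _ := by field_simp; ring

lemma one_le_uSmo {α₁ : ℝ} : 1 ≤ uSmo α₁ := by
  unfold uSmo
  have : 0 ≤ 1 / (2 * √α₁) := by positivity
  linarith

lemma rho1_le : rho1 ≤ 1634 / 10000 := by
  have h : √76015 ≤ 276 := by
    rw [Real.sqrt_le_left (by norm_num)]; norm_num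
  unfold rho1
  linarith

lemma rho2_le : rho2 ≤ 1634 / 10000 := by
  have h : √39 ≤ 62451 / 10000 := by
    rw [Real.sqrt_le_left (by norm_num)]; norm_num
  unfold rho2
  linarith

lemma tau2_le : tau2 ≤ 3 := by
  have h : 5105 ≤ √45678865 := by
    rw [Real.le_sqrt' (by norm_num)]; norm_num
  unfold tau2
  linarith

lemma Admissible.rho_le {α₁ α₂ ρ : ℝ} (h : Admissible α₁ α₂ ρ) : ρ ≤ 1634 / 10000 := by
  obtain ⟨-, -, ⟨-, h, -⟩ | ⟨-, h, -⟩⟩ := h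
  · exact h.trans rho1_le
  · exact h.trans rho2_le

/-- Together with ρ ≤ 0.1634, this is what the curvature comparison takes from the upper constraint
on α₂ in both ranges: it yields 1 + α₂ ≤ 3α₁, hence β ≤ 7/4. -/
lemma Admissible.curvU_le {α₁ α₂ ρ : ℝ} (h : Admissible α₁ α₂ ρ) : curvU α₂ ρ ≤ 3 * α₁ := by
  unfold curvU
  obtain ⟨hα₁, -, ⟨-, -, h⟩ | ⟨h1, -, h⟩⟩ := h
  · linarith
  · have h2 : 0 ≤ (3 - tau2) * (ρ - rho1) / (1 / 6 - rho1) := by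
      have h3 := tau2_le
      have h4 := rho1_le
      exact div_nonneg (mul_nonneg (by linarith) (by linarith)) (by linarith)
    nlinarith [mul_nonneg h2 hα₁.le]

/-- The lower bound for the curvature which the minorant provides, times `1 + α₂`. -/
def curvBound (α₁ α₂ ρ : ℝ) : ℝ :=
  1 / 2 - (1 + (1 + α₂) / (4 * α₁)) * (2 / 3 * ρ + 26 / 5 * ρ ^ 2)

lemma Admissible.le_curvBound {α₁ α₂ ρ : ℝ} (h : Admissible α₁ α₂ ρ) (hρ : 0 < ρ) :
    1 / 2 - 7 / 4 * (2 / 3 * ρ + 26 / 5 * ρ ^ 2) ≤ curvBound α₁ α₂ ρ := by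
  have hα₁ := h.1
  have hU := h.curvU_le
  unfold curvU at hU
  have h1 : (1 + α₂) / (4 * α₁) ≤ 3 / 4 := by
    rw [div_le_div_iff₀ (by positivity) (by norm_num)]
    nlinarith [sq_nonneg ρ]
  have h2 : (1 + (1 + α₂) / (4 * α₁)) * (2 / 3 * ρ + 26 / 5 * ρ ^ 2)
      ≤ 7 / 4 * (2 / 3 * ρ + 26 / 5 * ρ ^ 2) := by
    gcongr
    linarith
  unfold curvBound
  linarith

lemma Admissible.curvBound_pos {α₁ α₂ ρ : ℝ} (h : Admissible α₁ α₂ ρ) (hρ : 0 < ρ) :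
    0 < curvBound α₁ α₂ ρ := by
  refine lt_of_lt_of_le ?_ (h.le_curvBound hρ)
  have := h.rho_le
  nlinarith

/-- Drop the nonnegative φ and the negative part of Φ₁, and use α₁ ≤ U in Φ₂. The first entry of the
minimum is then at most (7/16 - 3ρ/2 + ρ²/2)/(4U), which is below `curvBound`/U for ρ ≤ 0.1634. -/
lemma Admissible.lCur_le {α₁ α₂ ρ : ℝ} (h : Admissible α₁ α₂ ρ) (hρ : 0 < ρ) :
    lCur α₁ α₂ ρ ≤ curvBound α₁ α₂ ρ / (1 + α₂) := by
  have hα₁ := h.1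
  have hα₂ : 0 < α₂ := lt_of_lt_of_le hα₁ h.2.1
  have hU3 := h.curvU_le
  have hρ1 := h.rho_le
  have hUV : 1 + α₂ ≤ curvU α₂ ρ := by unfold curvU; nlinarith
  have hU : 0 < curvU α₂ ρ := by linarith
  have hUα : α₁ ≤ curvU α₂ ρ := by linarith [h.2.1]
  refine (min_le_left _ _).trans ?_
  have hφ : 0 ≤ curvVarphi α₁ α₂ ρ := by
    have h1 : 16 * curvU α₂ ρ * curvPsi α₁ α₂ ρ = 63 / 8 - 9 / 8 * (curvU α₂ ρ / α₁) := by
      unfold curvPsi; field_simp; ring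
    have h2 : curvU α₂ ρ / α₁ ≤ 3 := by rwa [div_le_iff₀ hα₁]
    have h3 : 0 ≤ 7 + 16 * curvU α₂ ρ * curvPsi α₁ α₂ ρ := by rw [h1]; linarith
    unfold curvVarphi
    positivity
  have hΦ₁ : curvPhi1 α₁ α₂ ρ ≤ (1 - 6 * ρ) / (4 * curvU α₂ ρ) := by
    unfold curvPhi1
    have : 0 ≤ ρ ^ 2 / (16 * ((1 - ρ) ^ 2 + α₁)) := by positivity
    linarith
  have hΦ₂ : curvPhi2 α₁ α₂ ρ ≤ (6 + 16 * ρ ^ 2) / (32 * curvU α₂ ρ) := by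
    unfold curvPhi2
    have h1 : 3 / (32 * curvU α₂ ρ) ≤ 3 / (32 * α₁) := by gcongr
    have h2 : (9 + 16 * ρ ^ 2) / (32 * curvU α₂ ρ)
        = (6 + 16 * ρ ^ 2) / (32 * curvU α₂ ρ) + 3 / (32 * curvU α₂ ρ) := by
      rw [← add_div]; ring
    linarith
  have hL := h.le_curvBound hρ
  have hLpos := h.curvBound_pos hρ
  calc (curvPhi1 α₁ α₂ ρ + curvPhi2 α₁ α₂ ρ - curvVarphi α₁ α₂ ρ) / 4
      ≤ ((1 - 6 * ρ) / (4 * curvU α₂ ρ) + (6 + 16 * ρ ^ 2) / (32 * curvU α₂ ρ)) / 4 := by linarith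
    _ = ((7 / 16 - 3 / 2 * ρ + 1 / 2 * ρ ^ 2) / 4) / curvU α₂ ρ := by field_simp; ring
    _ ≤ curvBound α₁ α₂ ρ / curvU α₂ ρ := by
      gcongr
      refine le_trans ?_ hL
      nlinarith
    _ ≤ curvBound α₁ α₂ ρ / (1 + α₂) := by gcongr

lemma curvBound_pos_of_le {α₁ α₂ ρ : ℝ} (hα₁ : 0 < α₁) (hα₂ : 0 ≤ α₂) (hρ : 0 < ρ)
    (hρ₀ : ρ ≤ 1 / (20 * (1 + (1 + α₂) / (4 * α₁)))) : 0 < curvBound α₁ α₂ ρ := by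
  unfold curvBound
  have h0 : 0 ≤ (1 + α₂) / (4 * α₁) := by positivity
  set β := 1 + (1 + α₂) / (4 * α₁)
  have hβ : 1 ≤ β := by linarith
  have h1 : β * ρ ≤ 1 / 20 := by
    rw [le_div_iff₀ (by positivity)] at hρ₀
    linarith
  have h2 : ρ ≤ 1 := by nlinarith
  nlinarith [mul_nonneg (by linarith : 0 ≤ β) hρ.le]

end Constants

/-! ### Choice of constants and transfer to an arbitrary probability space -/

section Main

open scoped ENNReal

/-- The conclusion of the stability theorem for a given realisation of the sampling vectors. -/
def IsStable {n m : ℕ} (a : Fin m → Vec n) (x : Vec n) (α₁ α₂ ρ μ c t₁ : ℝ) (c₃ : ℝ → ℝ) : Prop :=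
  ∀ Cx : ℝ, 0 < Cx → (∀ j, Cx * ‖x‖ ≤ ‖inner ℂ (a j) x‖) →
    ∀ (b : Fin m → ℝ) (η : EuclideanSpace ℝ (Fin m)),
    (∀ j, α₁ * ‖inner ℂ (a j) x‖ ^ 2 ≤ b j ∧ b j ≤ α₂ * ‖inner ℂ (a j) x‖ ^ 2) →
    ‖η‖ / √(m : ℝ) ≤ c * ‖x‖ →
    ∀ z₀ ∈ nbhd x ρ, ∀ k : ℕ,
      phaseDist (wfIter a (noisyMeas a x b η) b μ z₀ (k + 1)) x
        ≤ c₃ Cx * (‖η‖ / (√(m : ℝ) * ‖x‖)) + (1 - t₁) ^ (((k : ℝ) + 1) / 2) * ‖x‖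

/-- At δ = 0 all the conditions hold strictly, and they are continuous in δ, so a small δ > 0 pays
for replacing expectations by sample averages. -/
lemma exists_slack {α₁ α₂ lam μ : ℝ} (hα₂ : 0 ≤ α₂) (hlam : 0 < lam) (hlam1 : lam ≤ 1 / 2)
    (hμ : 0 < μ) (hμ1 : μ < 2 * (lam / (1 + α₂)) / uSmo α₁ ^ 2) :
    ∃ δ : ℝ, 0 < δ ∧ δ ≤ 1 ∧ 0 < lam - δ ∧ μ * (1 + δ) < 2 ∧
      0 < 2 * μ * ((lam - δ) / (1 + α₂)) - (μ * ((1 + δ) * uSmo α₁)) ^ 2 := by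
  have hu := one_le_uSmo (α₁ := α₁)
  rw [lt_div_iff₀ (by positivity)] at hμ1
  have hdiv : lam / (1 + α₂) ≤ 1 / 2 := by
    rw [div_le_iff₀ (by positivity)]
    linarith
  have hμ2 : μ < 2 := by nlinarith
  have h1 : ∀ᶠ δ : ℝ in nhdsWithin 0 (Set.Ioi 0), 0 < lam - δ := by
    refine Filter.Eventually.filter_mono nhdsWithin_le_nhds ?_
    have : ContinuousAt (fun δ : ℝ => lam - δ) 0 := by fun_prop
    exact this.eventually (lt_mem_nhds (by simpa using hlam))
  have h2 : ∀ᶠ δ : ℝ in nhdsWithin 0 (Set.Ioi 0), μ * (1 + δ) < 2 := by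
    refine Filter.Eventually.filter_mono nhdsWithin_le_nhds ?_
    have : ContinuousAt (fun δ : ℝ => μ * (1 + δ)) 0 := by fun_prop
    exact this.eventually (gt_mem_nhds (by simpa using hμ2))
  have h3 : ∀ᶠ δ : ℝ in nhdsWithin 0 (Set.Ioi 0),
      0 < 2 * μ * ((lam - δ) / (1 + α₂)) - (μ * ((1 + δ) * uSmo α₁)) ^ 2 := by
    refine Filter.Eventually.filter_mono nhdsWithin_le_nhds ?_
    have : ContinuousAt (fun δ : ℝ =>
      2 * μ * ((lam - δ) / (1 + α₂)) - (μ * ((1 + δ) * uSmo α₁)) ^ 2) 0 := by fun_prop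
    refine this.eventually (lt_mem_nhds ?_)
    simp only [sub_zero, add_zero, one_mul]
    nlinarith
  have h4 : ∀ᶠ δ : ℝ in nhdsWithin 0 (Set.Ioi 0), δ ∈ Set.Ioo (0 : ℝ) 1 :=
    Ioo_mem_nhdsGT one_pos
  obtain ⟨δ, hd1, hd2, hd3, hd4⟩ := (h1.and (h2.and (h3.and h4))).exists
  exact ⟨δ, hd4.1, hd4.2.le, hd1, hd2, hd3⟩

theorem exists_stability_constants {α₁ α₂ ρ μ : ℝ} (hα₁ : 0 < α₁) (hα₂ : α₁ ≤ α₂) (hρ : 0 < ρ)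
    (hρ1 : ρ ≤ 1) (hcurv : 0 < curvBound α₁ α₂ ρ) (hμ : 0 < μ)
    (hμ1 : μ < 2 * (curvBound α₁ α₂ ρ / (1 + α₂)) / uSmo α₁ ^ 2) (c : ℝ) :
    ∃ C c₁ c₂ t₁ : ℝ, ∃ c₃ : ℝ → ℝ,
      0 < C ∧ 0 < c₁ ∧ 0 < c₂ ∧ 0 < t₁ ∧ t₁ < 1 ∧ (∀ κ : ℝ, 0 < κ → 0 < c₃ κ) ∧
      ∀ (n m : ℕ), C * (n : ℝ) ≤ (m : ℝ) → ∀ x : Vec n, x ≠ 0 →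
        sampleLaw n m {a | ¬ IsStable a x α₁ α₂ ρ μ c t₁ c₃}
          < ENNReal.ofReal (c₁ * Real.exp (-c₂ * (m : ℝ))) := by
  have hα₂0 : 0 < α₂ := lt_of_lt_of_le hα₁ hα₂
  set β := 1 + (1 + α₂) / (4 * α₁) with hβdef
  have hβ : 0 < β := by positivity
  have hκ : 0 < ρ ^ 2 := by positivity
  have hκ1 : ρ ^ 2 ≤ 1 := pow_le_one₀ hρ.le hρ1
  set lam := 1 / 2 - β * (2 * ρ ^ 2 * (1 + Real.log (1 / ρ ^ 2))) with hlam
  have hcurv_le : curvBound α₁ α₂ ρ ≤ lam := by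
    rw [curvBound, hlam]
    have := mul_le_mul_of_nonneg_left (tail_constant_le hρ) hβ.le
    linarith
  have hlam_half : lam ≤ 1 / 2 := by
    have hlog : 0 ≤ Real.log (1 / ρ ^ 2) := Real.log_nonneg (by rw [le_div_iff₀ hκ]; linarith)
    have : 0 ≤ β * (2 * ρ ^ 2 * (1 + Real.log (1 / ρ ^ 2))) := by positivity
    linarith
  have hμ2 : μ < 2 * (lam / (1 + α₂)) / uSmo α₁ ^ 2 := lt_of_lt_of_le hμ1 (by gcongr)
  obtain ⟨δ, hδ, hδ1, hlamδ, hμδ, hν⟩ := exists_slack hα₂0.le (hcurv.trans_le hcurv_le) hlam_half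
    hμ hμ2
  set ν := 2 * μ * ((lam - δ) / (1 + α₂)) - (μ * ((1 + δ) * uSmo α₁)) ^ 2 with hνdef
  -- Capping at 1/2 keeps t₁ < 1; decreasing t₁ only weakens the required contraction.
  set t₁ := min ν (1 / 2) with ht₁
  have ht₁0 : 0 < t₁ := by positivity
  have ht₁1 : t₁ < 1 := lt_of_le_of_lt (min_le_right _ _) (by norm_num)
  set q := √(1 - t₁) with hq
  have hqsq : q ^ 2 = 1 - t₁ := Real.sq_sqrt (by linarith)
  have hq0 : 0 ≤ q := Real.sqrt_nonneg _
  have hq1 : q < 1 := by rw [hq, Real.sqrt_lt' one_pos]; linarith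
  set ν₂ := μ * (2 - μ * (1 + δ)) * (lam - δ) with hν₂
  have hν₂0 : 0 < ν₂ := mul_pos (mul_pos hμ (by linarith)) hlamδ
  set p := √(1 - ν₂) with hp
  have hp0 : 0 ≤ p := Real.sqrt_nonneg _
  have hp1 : p < 1 := by rw [hp, Real.sqrt_lt' one_pos]; linarith
  -- If ν₂ > 1, then p = 0 by the convention for square roots, and the inequality still holds.
  have hpsq : 1 - ν₂ ≤ p ^ 2 := by rw [hp, Real.sq_sqrt']; exact le_max_left _ _
  obtain ⟨C, r, hC, hr, hprob⟩ := sampleLaw_not_isRegular_le hβ.le hκ hκ1 hδ hδ1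
  set K := ((3 + μ * (1 + δ) * ((1 + α₂) / (2 * √α₁)) / (1 - p)) / ((1 - q) * ρ)
        + 1 / (1 - p) + 1 / (1 - q)) with hK
  have hp' : 0 < 1 - p := by linarith
  have hq' : 0 < 1 - q := by linarith
  have hK0 : 0 < K := by positivity
  -- The constant 3 in place of the 2 from the union bound makes the final inequality strict.
  refine ⟨C, 3, r, t₁, fun Cx => (μ * √(1 + δ) / (2 * √α₁ * Cx)) * K, hC, by norm_num, hr, ht₁0,
    ht₁1, fun κ hκ => by positivity, fun n m hnm x hx => ?_⟩
  have hn : 0 < n := by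
    rcases Nat.eq_zero_or_pos n with rfl | h
    · exact absurd (Subsingleton.elim x 0) hx
    · exact h
  have hm : 0 < m := by
    have h1 : (0 : ℝ) < n := by exact_mod_cast hn
    have h2 : (0 : ℝ) < m := lt_of_lt_of_le (by positivity) hnm
    exact_mod_cast h2
  have hx' : ‖x‖ ≠ 0 := norm_ne_zero_iff.2 hx
  have he : ‖(‖x‖⁻¹ : ℂ) • x‖ = 1 := by
    rw [norm_smul, norm_inv, Complex.norm_real, norm_norm, inv_mul_cancel₀ hx']
  have hsub : {a : Fin m → Vec n | ¬ IsStable a x α₁ α₂ ρ μ c t₁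
      (fun Cx => (μ * √(1 + δ) / (2 * √α₁ * Cx)) * K)}
      ⊆ {a | ¬ IsRegular a ((‖x‖⁻¹ : ℂ) • x) (1 + δ) (lam - δ) β (ρ ^ 2)} := by
    intro a ha hreg
    refine ha fun Cx hCx hax b η hb _ z₀ hz₀ k => ?_
    have hmain := hreg.phaseDist_wfIter_le hα₁ hα₂ hx hm (by positivity) hρ hρ1 hCx hax hb η hμ hp0
      hp1 hμδ.le hpsq hq0 hq1 (by
        rw [hqsq]
        have := min_le_left ν (1 / 2)
        linarith) hz₀ k
    have hpow : (1 - t₁) ^ (((k : ℝ) + 1) / 2) = q ^ (k + 1) := by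
      rw [hq, Real.sqrt_eq_rpow, ← Real.rpow_natCast, ← Real.rpow_mul (by linarith)]
      congr 1
      push_cast
      ring
    rw [hpow]
    exact hmain
  refine lt_of_le_of_lt ((measure_mono hsub).trans (hprob n m hnm _ he)) ?_
  refine (ENNReal.ofReal_lt_ofReal_iff (by positivity)).2 ?_
  have := Real.exp_pos (-r * m)
  linarith

/-- Transfer of an outer-measure bound from the canonical sample space. -/
lemma measure_le_sampleLaw {n m : ℕ} {Ω : Type*} [MeasurableSpace Ω] {P : Measure Ω}
    [IsProbabilityMeasure P] {a : Fin m → Ω → Vec n}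
    (hlaw : ∀ j, HasLaw (a j) (stdComplexGaussianVec n) P) (hind : iIndepFun a P)
    (B : Set (Fin m → Vec n)) : P {ω | (fun j => a j ω) ∈ B} ≤ sampleLaw n m B := by
  have hmap := (iIndepFun_iff_map_fun_eq_pi_map fun j => (hlaw j).aemeasurable).1 hind
  simp_rw [fun j => (hlaw j).map_eq] at hmap
  change _ ≤ (Measure.pi fun _ => stdComplexGaussianVec n) B
  rw [← hmap]
  -- This inequality holds for every set B, so no measurability of the failure event is needed.
  exact Measure.le_map_apply (aemeasurable_pi_lambda _ fun j => (hlaw j).aemeasurable) B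

end Main

end PoissonWF

end

theorem theorem2 (α₁ α₂ : ℝ) (hα₁ : 0 < α₁) (hα₂ : α₁ ≤ α₂) :
    -- all small radii are allowed, and all radii in the explicit range
    ∃ ρ₀ : ℝ, 0 < ρ₀ ∧ ∀ ρ : ℝ, 0 < ρ → (ρ ≤ ρ₀ ∨ PoissonWF.Admissible α₁ α₂ ρ) →
    -- all small step sizes are allowed, and all `μ < 2 l_cur / u_smo ^ 2` in the explicit range
    ∃ μ₀ : ℝ, 0 < μ₀ ∧ ∀ μ : ℝ, 0 < μ →
      (μ < μ₀ ∨ (PoissonWF.Admissible α₁ α₂ ρ ∧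
        μ < 2 * PoissonWF.lCur α₁ α₂ ρ / PoissonWF.uSmo α₁ ^ 2)) →
    ∀ c : ℝ, 0 < c →
    ∃ C c₁ c₂ t₁ : ℝ, ∃ c₃ : ℝ → ℝ,
      0 < C ∧ 0 < c₁ ∧ 0 < c₂ ∧ 0 < t₁ ∧ t₁ < 1 ∧ (∀ κ : ℝ, 0 < κ → 0 < c₃ κ) ∧
      ∀ (n m : ℕ), C * (n : ℝ) ≤ (m : ℝ) →
      ∀ x : PoissonWF.Vec n, x ≠ 0 →
      ∀ (Ω : Type*) [MeasurableSpace Ω] (P : MeasureTheory.Measure Ω)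
        [MeasureTheory.IsProbabilityMeasure P] (a : Fin m → Ω → PoissonWF.Vec n),
      (∀ j, ProbabilityTheory.HasLaw (a j) (PoissonWF.stdComplexGaussianVec n) P) →
      ProbabilityTheory.iIndepFun a P →
      -- the probability that the following fails is less than `c₁ exp (-c₂ m)`
      P {ω | ¬ (∀ Cx : ℝ, 0 < Cx → (∀ j, Cx * ‖x‖ ≤ ‖inner ℂ (a j ω) x‖) →
          ∀ (b : Fin m → ℝ) (η : EuclideanSpace ℝ (Fin m)),
          (∀ j, α₁ * ‖inner ℂ (a j ω) x‖ ^ 2 ≤ b j ∧ b j ≤ α₂ * ‖inner ℂ (a j ω) x‖ ^ 2) →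
          ‖η‖ / √(m : ℝ) ≤ c * ‖x‖ →
          ∀ z₀ ∈ PoissonWF.nbhd x ρ, ∀ k : ℕ,
            PoissonWF.phaseDist
              (PoissonWF.wfIter (fun j => a j ω)
                (PoissonWF.noisyMeas (fun j => a j ω) x b η) b μ z₀ (k + 1)) x
              ≤ c₃ Cx * (‖η‖ / (√(m : ℝ) * ‖x‖))
                + (1 - t₁) ^ (((k : ℝ) + 1) / 2) * ‖x‖)}
        < ENNReal.ofReal (c₁ * Real.exp (-c₂ * (m : ℝ))) := by

  have hα₂0 : 0 < α₂ := lt_of_lt_of_le hα₁ hα₂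
  refine ⟨1 / (20 * (1 + (1 + α₂) / (4 * α₁))), by positivity, fun ρ hρ hρ' => ?_⟩
  have hρ1 : ρ ≤ 1 := by
    rcases hρ' with h | h
    · have h1 : 0 ≤ (1 + α₂) / (4 * α₁) := by positivity
      refine h.trans ?_
      rw [div_le_one (by positivity)]
      linarith
    · have := h.rho_le
      linarith
  have hcurv : 0 < PoissonWF.curvBound α₁ α₂ ρ := by
    rcases hρ' with h | h
    · exact PoissonWF.curvBound_pos_of_le hα₁ hα₂0.le hρ h
    · exact h.curvBound_pos hρ
  have hu := PoissonWF.one_le_uSmo (α₁ := α₁)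
  -- This μ₀ is the contraction threshold given by the minorant; the explicit step sizes lie below
  -- it by `Admissible.lCur_le`.
  refine ⟨2 * (PoissonWF.curvBound α₁ α₂ ρ / (1 + α₂)) / PoissonWF.uSmo α₁ ^ 2, by positivity,
    fun μ hμ hμ' c _ => ?_⟩
  have hμ1 : μ < 2 * (PoissonWF.curvBound α₁ α₂ ρ / (1 + α₂)) / PoissonWF.uSmo α₁ ^ 2 := by
    rcases hμ' with h | ⟨hadm, h⟩
    · exact h
    · refine h.trans_le ?_
      gcongr
      exact hadm.lCur_le hρ
  obtain ⟨C, c₁, c₂, t₁, c₃, hC, hc₁, hc₂, ht₁, ht₁1, hc₃, hmain⟩ :=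
    PoissonWF.exists_stability_constants hα₁ hα₂ hρ hρ1 hcurv hμ hμ1 c
  refine ⟨C, c₁, c₂, t₁, c₃, hC, hc₁, hc₂, ht₁, ht₁1, hc₃, ?_⟩
  intro n m hnm x hx Ω _ P _ a hlaw hind
  exact (PoissonWF.measure_le_sampleLaw hlaw hind
    {a | ¬ PoissonWF.IsStable a x α₁ α₂ ρ μ c t₁ c₃}).trans_lt (hmain n m hnm x hx)
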